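/- **Setting.** Let $z_0=(0,0)$, $z_1=(1,0)$, $z_2=(\frac12,\frac{\sqrt3}{2})$ in $\mathbb R^2$, let $f_i(p)=\frac12p+\frac12z_i$ for $i\in M=\{0,1,2\}$, let $S$ be the Sierpinski gasket, i.e. the unique nonempty compact set with $S=f_0(S)\cup f_1(S)\cup f_2(S)$, and let $s=\frac{\log 3}{\log 2}$ be its similarity dimension. $B(x,d)$ denotes the closed Euclidean ball of centre $x$ and radius $d>0$. *Metric measures.* For $A\subset\mathbb R^2$ let $$C_0^s(A)=\lim_{\delta\to0}\inf\Big\{\sum_i(2d_i)^s\Big\},$$ the infimum being over all countable coverings of $A$ by balls $B(x_i,d_i)$ with $x_i\in A$, $2d_i\le\delta$, and let $C^s(A)=\sup\{C_0^s(F):F\subset A,\ F\text{ closed}\}$ (centred Hausdorff measure). Let $$P_0^s(A)=\lim_{\delta\to0}\sup\Big\{\sum_i(2d_i)^s\Big\},$$ the supremum being over all countable families of pairwise disjoint balls $B(x_i,d_i)$ with $x_i\in A$, $2d_i\le\delta$, and let $P^s(A)=\inf\{\sum_{i}P_0^s(F_i)\}$, the infimum being over all countable coverings $\{F_i\}$ of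 $A$ by closed sets (packing measure). $\mathcal H^s$ is the Hausdorff measure, and $\mathcal H^s_{Sph}$ is the spherical Hausdorff measure, defined as $C_0^s$ but without requiring the centres $x_i$ to lie in $A$. The natural probability measure $\mu$ is the compactly supported Borel probability measure on $\mathbb R^2$ with $\mu=\sum_{i\in M}2^{-s}\,\mu\circ f_i^{-1}$. Let $\alpha$ be an $s$-dimensional metric measure on $S$, i.e. $\alpha$ is one of $\mu$, $\mathcal H^s\lfloor_S$, $\mathcal H^s_{Sph}\lfloor_S$, $C^s\lfloor_S$, $P^s\lfloor_S$. *Densities.* Put $\theta_\alpha^s(x,d)=\dfrac{\alpha(B(x,d))}{(2d)^s}$, $\underline\theta_\alpha^s(x)=\liminf_{d\to0}\theta_\alpha^s(x,d)$, $\overline\theta_\alpha^s(x)=\limsup_{d\to0}\theta_\alpha^s(x,d)$, and, for $A\subset\mathbb R^2$, let $Spec(\alpha,A)$ be the set of all limits $\lim_{k\to\infty}\theta_\alpha^s(x,d_k)$ with $x\in A$, $d_k>0$ and $d_k\to0$; $Spec(\alpha,y)=Spec(\alpha,\{y\})$. *Feasible sets and typical balls.* An open set $\mathcal R\subset\mathbb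 R^2$ is feasible if $\mathcal R\cap S\ne\varnothing$, $f_i(\mathcal R)\subset\mathcal R$ for all $i$, and $f_i(\mathcal R)\cap f_j(\mathcal R)=\varnothing$ for $i\ne j$. A ball $B(x,d)$ is typical if $x\in S$ and $B(x,d)$ is contained in some feasible open set; $\mathcal B$ is the set of typical balls and $Im(\theta_\alpha^s,\mathcal B)=\{\theta_\alpha^s(x,d):B(x,d)\in\mathcal B\}$. *Dense shift orbits.* For $i=i_1i_2\dots\in M^{\mathbb N}$ let $\pi(i)$ be the point of $\bigcap_kf_{i_1}\circ\dots\circ f_{i_k}(S)$, let $\sigma$ be the left shift on $M^{\mathbb N}$, let $\mathcal T=\pi\circ\sigma\circ\pi^{-1}$ (a correspondence on $S$), and let $\widehat S$ be the set of $y\in S$ for which $\bigcup_k\mathcal T^k(y)$ is dense in $S$. **Theorem.** The numbers $\alpha(S)$, $P^s(S)$, $C^s(S)$ are positive and finite, and the following hold. (i) For every $y\in\widehat S$ and every feasible open set $\mathcal R$, $$Spec(\alpha,y)=Spec(\alpha,\widehat S)=Spec(\alpha,\mathcal R\cap S)=Im(\theta_\alpha^s,\mathcal B)=\Big[\frac{\alpha(S)}{P^s(S)},\frac{\alpha(S)}{C^s(S)}\Big];$$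 the equalities not involving $y$ or $\mathcal R$ hold without reference to them. (ii) $Spec(\alpha,S)$ is the union of two closed intervals of positive length, $$Spec(\alpha,S)=\big[\underline\theta_\alpha^s(z_0),\overline\theta_\alpha^s(z_0)\big]\cup\Big[\frac{\alpha(S)}{P^s(S)},\frac{\alpha(S)}{C^s(S)}\Big],$$ where $$\underline\theta_\alpha^s(z_0)=\min\{\theta_\alpha^s(z_0,d):\tfrac12\le d\le1\},\qquad\overline\theta_\alpha^s(z_0)=\max\{\theta_\alpha^s(z_0,d):\tfrac12\le d\le1\}.$$ -/

import Mathlib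

open Set Filter Topology MeasureTheory
open scoped ENNReal NNReal

noncomputable section

namespace SierpinskiGasket

/-- The Euclidean plane. -/
abbrev Plane : Type := EuclideanSpace ℝ (Fin 2)

/-! ### The iterated function system and the gasket -/

/-- The vertices `z₀ = (0,0)`, `z₁ = (1,0)`, `z₂ = (1/2, √3/2)`. -/
def vertex : Fin 3 → Plane := ![!₂[0, 0], !₂[1, 0], !₂[1 / 2, Real.sqrt 3 / 2]]

/-- The similitudes `fᵢ(p) = p/2 + zᵢ/2`, of contraction ratio `1/2` and with fixed point `zᵢ`. -/
def simil (i : Fin 3) (p : Plane) : Plane := (1 / 2 : ℝ) • p + (1 / 2 : ℝ) • vertex i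

/-- `K` is the nonempty compact set generated by the system: `K = f₀(K) ∪ f₁(K) ∪ f₂(K)`. -/
def IsAttractor (K : Set Plane) : Prop :=
  K.Nonempty ∧ IsCompact K ∧ K = ⋃ i : Fin 3, simil i '' K

theorem edist_simil (i : Fin 3) (x y : Plane) :
    edist (simil i x) (simil i y) = ((1 / 2 : ℝ≥0) : ℝ≥0∞) * edist x y := by
  unfold simil
  rw [edist_add_right, edist_smul₀, ENNReal.smul_def, smul_eq_mul]
  congr 2
  ext
  simp

theorem continuous_simil (i : Fin 3) : Continuous (simil i) := by
  unfold simil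
  fun_prop

theorem hausdorffEDist_simil_le (i : Fin 3) (K L : Set Plane) :
    Metric.hausdorffEDist (simil i '' K) (simil i '' L)
      ≤ ((1 / 2 : ℝ≥0) : ℝ≥0∞) * Metric.hausdorffEDist K L := by
  have key : ∀ A B : Set Plane, ∀ x ∈ simil i '' A,
      Metric.infEDist x (simil i '' B) ≤ ((1 / 2 : ℝ≥0) : ℝ≥0∞) * Metric.hausdorffEDist A B := by
    rintro A B _ ⟨a, ha, rfl⟩
    refine le_trans ?_ (mul_le_mul_right (Metric.infEDist_le_hausdorffEDist_of_mem ha) _)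
    have hc : ((1 / 2 : ℝ≥0) : ℝ≥0∞) ≠ ⊤ := ENNReal.coe_ne_top
    have hc0 : ((1 / 2 : ℝ≥0) : ℝ≥0∞) ≠ 0 := by simp
    rw [Metric.infEDist, Metric.infEDist, ENNReal.mul_iInf_of_ne hc0 hc]
    refine le_iInf fun b => ?_
    rw [ENNReal.mul_iInf_of_ne hc0 hc]
    refine le_iInf fun hb => ?_
    rw [← edist_simil]
    exact iInf₂_le _ (mem_image_of_mem _ hb)
  refine Metric.hausdorffEDist_le_of_infEDist (key K L) fun x hx => ?_
  rw [Metric.hausdorffEDist_comm]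
  exact key L K x hx

/-- The set map `K ↦ f₀(K) ∪ f₁(K) ∪ f₂(K)` on nonempty compact sets. -/
def setMap (K : TopologicalSpace.NonemptyCompacts Plane) :
    TopologicalSpace.NonemptyCompacts Plane :=
  ⟨⟨⋃ i : Fin 3, simil i '' K, isCompact_iUnion fun i => K.isCompact.image (continuous_simil i)⟩,
    nonempty_iUnion.2 ⟨0, K.nonempty.image _⟩⟩

theorem contracting_setMap : ContractingWith (1 / 2) setMap := by
  refine ⟨by rw [← NNReal.coe_lt_coe]; norm_num, fun K L => ?_⟩
  change Metric.hausdorffEDist (⋃ i : Fin 3, simil i '' (K : Set Plane))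
    (⋃ i : Fin 3, simil i '' (L : Set Plane)) ≤ _ * Metric.hausdorffEDist (K : Set Plane) L
  exact Metric.hausdorffEDist_iUnion_le.trans (iSup_le fun i => hausdorffEDist_simil_le i _ _)

theorem existsUnique_attractor : ∃! K : Set Plane, IsAttractor K := by
  have : Nonempty (TopologicalSpace.NonemptyCompacts Plane) := ⟨{0}⟩
  have hf := contracting_setMap
  refine ⟨(ContractingWith.fixedPoint setMap hf : TopologicalSpace.NonemptyCompacts Plane),
    ⟨TopologicalSpace.NonemptyCompacts.nonempty _,
      TopologicalSpace.NonemptyCompacts.isCompact _, ?_⟩, ?_⟩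
  · exact (congrArg (fun K : TopologicalSpace.NonemptyCompacts Plane => (K : Set Plane))
      hf.fixedPoint_isFixedPt).symm
  · rintro L ⟨hne, hc, hL⟩
    have hfix : Function.IsFixedPt setMap ⟨⟨L, hc⟩, hne⟩ :=
      TopologicalSpace.NonemptyCompacts.ext hL.symm
    exact congrArg (fun K : TopologicalSpace.NonemptyCompacts Plane => (K : Set Plane))
      (hf.fixedPoint_unique hfix)

/-- The Sierpinski gasket `S`. -/
def gasket : Set Plane := Classical.choose existsUnique_attractor.exists

theorem gasket_spec : IsAttractor gasket := Classical.choose_spec existsUnique_attractor.exists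

theorem eq_gasket {K : Set Plane} (hK : IsAttractor K) : K = gasket :=
  existsUnique_attractor.unique hK gasket_spec

/-- The similarity dimension `s = log 3 / log 2`, i.e. the solution of `3 · (1/2)^s = 1`. -/
def dimS : ℝ := Real.log 3 / Real.log 2

/-! ### Geometric shift and points with dense shift orbit -/

/-- `wordMap i k = f_{i₀} ∘ ⋯ ∘ f_{i_{k-1}}`. -/
def wordMap (i : ℕ → Fin 3) : ℕ → Plane → Plane
  | 0 => id
  | k + 1 => wordMap i k ∘ simil (i k)

/-- `i` is a code of `x`: `x` lies in all the cylinders `f_{i₀ ⋯ i_{k-1}}(S)`, whose intersection is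
the single point `π(i)`. Thus `IsCode i x` says `π(i) = x`. -/
def IsCode (i : ℕ → Fin 3) (x : Plane) : Prop := ∀ k, x ∈ wordMap i k '' gasket

/-- The geometric shift `T = π ∘ σ ∘ π⁻¹`, a correspondence, acting on sets of points. -/
def geomShift (A : Set Plane) : Set Plane :=
  {z | ∃ x ∈ A, ∃ i : ℕ → Fin 3, IsCode i x ∧ IsCode (fun n => i (n + 1)) z}

/-- The set `Ŝ` of those points of `S` whose shift orbit `⋃ₖ Tᵏ(y)` is dense in `S`. -/
def denseOrbitPoints : Set Plane :=
  {y | y ∈ gasket ∧ gasket ⊆ closure (⋃ k : ℕ, geomShift^[k] {y})}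

/-! ### Feasible open sets and typical balls -/

/-- Feasible open sets: those of the (strong) open set condition. -/
def IsFeasible (O : Set Plane) : Prop :=
  IsOpen O ∧ (∀ i, simil i '' O ⊆ O) ∧
    (∀ i j, i ≠ j → Disjoint (simil i '' O) (simil j '' O)) ∧ (O ∩ gasket).Nonempty

/-- The closed ball `B(x,d)` is typical: centred in `S` and contained in a feasible open set. -/
def IsTypical (x : Plane) (d : ℝ) : Prop :=
  x ∈ gasket ∧ 0 < d ∧ ∃ O, IsFeasible O ∧ Metric.closedBall x d ⊆ O

/-! ### Metric measures

These are set functions with values in `[0,∞]`; they will be evaluated on compact sets only. -/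

/-- A countable family of closed balls `B(x,d)`, `d > 0`, encoded by the pairs `(x,d)`, with all
the diameters `2d` at most `δ`. -/
def IsFineFamily (δ : ℝ) (t : Set (Plane × ℝ)) : Prop :=
  t.Countable ∧ ∀ p ∈ t, 0 < p.2 ∧ 2 * p.2 ≤ δ

/-- The balls of the family `t` cover `A`. -/
def Covers (t : Set (Plane × ℝ)) (A : Set Plane) : Prop :=
  A ⊆ ⋃ p ∈ t, Metric.closedBall p.1 p.2

/-- The sum `∑ (2d)^s` over the balls of the family. -/
def diamSum (s : ℝ) (t : Set (Plane × ℝ)) : ℝ≥0∞ :=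
  ∑' p : t, ENNReal.ofReal ((2 * (p : Plane × ℝ).2) ^ s)

/-- The spherical Hausdorff measure (the limit as `δ → 0` is a supremum by monotonicity). -/
def sphericalHausdorff (s : ℝ) (A : Set Plane) : ℝ≥0∞ :=
  ⨆ (δ : ℝ) (_ : 0 < δ), ⨅ (t : Set (Plane × ℝ)) (_ : IsFineFamily δ t ∧ Covers t A), diamSum s t

/-- The premeasure `C₀ˢ`: coverings by closed balls centred in the set. -/
def centredPre (s : ℝ) (A : Set Plane) : ℝ≥0∞ :=
  ⨆ (δ : ℝ) (_ : 0 < δ), ⨅ (t : Set (Plane × ℝ))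
    (_ : IsFineFamily δ t ∧ (∀ p ∈ t, p.1 ∈ A) ∧ Covers t A), diamSum s t

/-- The centred Hausdorff measure `Cˢ`. -/
def centredHausdorff (s : ℝ) (A : Set Plane) : ℝ≥0∞ :=
  ⨆ (F : Set Plane) (_ : F ⊆ A ∧ IsClosed F), centredPre s F

/-- The premeasure `P₀ˢ`: packings by disjoint closed balls centred in the set (the limit as
`δ → 0` is an infimum by monotonicity). -/
def packingPre (s : ℝ) (A : Set Plane) : ℝ≥0∞ :=
  ⨅ (δ : ℝ) (_ : 0 < δ), ⨆ (t : Set (Plane × ℝ))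
    (_ : IsFineFamily δ t ∧ (∀ p ∈ t, p.1 ∈ A) ∧
      t.PairwiseDisjoint (fun p => Metric.closedBall p.1 p.2)), diamSum s t

/-- The packing measure `Pˢ`. -/
def packing (s : ℝ) (A : Set Plane) : ℝ≥0∞ :=
  ⨅ (F : ℕ → Set Plane) (_ : (∀ n, IsClosed (F n)) ∧ A ⊆ ⋃ n, F n), ∑' n, packingPre s (F n)

/-- The natural probability measure: the compactly supported Borel probability measure that is
fixed by the Markov operator with weights `rᵢˢ = (1/2)ˢ`. -/
def IsNaturalMeasure (μ : Measure Plane) : Prop :=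
  IsProbabilityMeasure μ ∧ (∃ K : Set Plane, IsCompact K ∧ μ Kᶜ = 0) ∧
    μ = ∑ i : Fin 3, ENNReal.ofReal ((1 / 2 : ℝ) ^ dimS) • μ.map (simil i)

/-- Restriction of a set function to `S`. -/
def restrictGasket (β : Set Plane → ℝ≥0∞) : Set Plane → ℝ≥0∞ := fun A => β (A ∩ gasket)

/-- The `s`-dimensional metric measures on `S`: the natural probability measure and the restrictions
to `S` of the Hausdorff, spherical Hausdorff, centred Hausdorff and packing measures. -/
def metricMeasures : Set (Set Plane → ℝ≥0∞) :=
  {α | (∃ μ : Measure Plane, IsNaturalMeasure μ ∧ α = fun A => μ A) ∨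
    α = restrictGasket (fun A => μH[dimS] A) ∨
    α = restrictGasket (sphericalHausdorff dimS) ∨
    α = restrictGasket (centredHausdorff dimS) ∨
    α = restrictGasket (packing dimS)}

/-! ### Densities and spectra -/

/-- The `s`-density `α(B(x,d)) / (2d)^s` of the closed ball `B(x,d)`, for `d > 0`. -/
def density (α : Set Plane → ℝ≥0∞) (x : Plane) (d : ℝ) : ℝ≥0∞ :=
  α (Metric.closedBall x d) / ENNReal.ofReal ((2 * d) ^ dimS)

/-- The lower density at `x`. -/
def lowerDensity (α : Set Plane → ℝ≥0∞) (x : Plane) : ℝ≥0∞ :=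
  liminf (fun d : ℝ => density α x d) (𝓝[>] 0)

/-- The upper density at `x`. -/
def upperDensity (α : Set Plane → ℝ≥0∞) (x : Plane) : ℝ≥0∞ :=
  limsup (fun d : ℝ => density α x d) (𝓝[>] 0)

/-- `Spec(α,A)`: all limits of densities of balls centred at a point of `A`, radii tending to `0`. -/
def densitySpectrum (α : Set Plane → ℝ≥0∞) (A : Set Plane) : Set ℝ≥0∞ :=
  {l | ∃ x ∈ A, ∃ d : ℕ → ℝ, (∀ k, 0 < d k) ∧ Tendsto d atTop (𝓝 0) ∧
    Tendsto (fun k => density α x (d k)) atTop (𝓝 l)}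

/-- `Im(θ_α^s, 𝓑)`: the densities of the typical balls. -/
def typicalDensities (α : Set Plane → ℝ≥0∞) : Set ℝ≥0∞ :=
  {l | ∃ x d, IsTypical x d ∧ l = density α x d}

end SierpinskiGasket

end

open SierpinskiGasket

/-!
The natural measure `ν` is self-similar, and any monotone, finitely subadditive set function that is
multiplied by at most `3⁻¹` under each similitude coincides on the traces of closed balls on the
gasket with a multiple of `ν`. This applies to the four metric measures, so every density is a
density of a self-similar measure.

The density of a typical ball does not change under the similitudes. Near a junction of two pieces
it does not change under the homothety of ratio `1 / 2` centred at the junction either. Typical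
balls can therefore be enlarged until they lie in a compact family, so that their densities form a
compact set. A dense shift orbit comes close to every typical ball and transports its density to
arbitrarily small radii, which gives the equality of the spectra and, by the intermediate value
theorem, an interval. All points of the gasket except the three vertices lie in one hexagonal
feasible set, and at a vertex the density is periodic under halving the radius.

Covering the gasket by balls of nearly maximal density, respectively packing it by balls of nearly
minimal density, by means of Besicovitch's theorem, identifies the end points of the interval.
-/

noncomputable section

namespace SierpinskiGasket

/-! ### The similitudes and the gasket -/

/-- The similitude `simil i` as a homeomorphism; its inverse is the homothety of ratio `2` centred
at `vertex i`. -/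
def similHomeomorph (i : Fin 3) : Plane ≃ₜ Plane where
  toFun := simil i
  invFun y := (2 : ℝ) • y - vertex i
  left_inv x := by simp only [simil]; module
  right_inv y := by simp only [simil]; module
  continuous_toFun := continuous_simil i
  continuous_invFun := by fun_prop

lemma injective_simil (i : Fin 3) : Function.Injective (simil i) := (similHomeomorph i).injective

lemma surjective_simil (i : Fin 3) : Function.Surjective (simil i) := (similHomeomorph i).surjective

lemma simil_similHomeomorph_symm (i : Fin 3) (y : Plane) :
    simil i ((similHomeomorph i).symm y) = y := (similHomeomorph i).apply_symm_apply y

lemma simil_vertex (i : Fin 3) : simil i (vertex i) = vertex i := by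
  simp only [simil]; module

lemma dist_simil (i : Fin 3) (x y : Plane) : dist (simil i x) (simil i y) = dist x y / 2 := by
  rw [simil, simil, dist_add_right, dist_smul₀, Real.norm_of_nonneg (by norm_num),
    one_div_mul_eq_div]

lemma dist_simil_vertex (i : Fin 3) (x : Plane) :
    dist (simil i x) (vertex i) = dist x (vertex i) / 2 := by
  conv_lhs => rw [← simil_vertex i, dist_simil]

lemma dist_similHomeomorph_symm (i : Fin 3) (x y : Plane) :
    dist ((similHomeomorph i).symm x) ((similHomeomorph i).symm y) = 2 * dist x y := by
  have h := dist_simil i ((similHomeomorph i).symm x) ((similHomeomorph i).symm y)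
  rw [simil_similHomeomorph_symm, simil_similHomeomorph_symm] at h
  linarith

lemma preimage_simil_closedBall (i : Fin 3) (x : Plane) (d : ℝ) :
    simil i ⁻¹' Metric.closedBall (simil i x) (d / 2) = Metric.closedBall x d := by
  ext y
  simp only [mem_preimage, Metric.mem_closedBall, dist_simil]
  exact div_le_div_iff_of_pos_right two_pos

lemma image_simil_closedBall (i : Fin 3) (x : Plane) (d : ℝ) :
    simil i '' Metric.closedBall x d = Metric.closedBall (simil i x) (d / 2) := by
  rw [← preimage_simil_closedBall i, image_preimage_eq _ (surjective_simil i)]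

lemma contractingWith_simil (i : Fin 3) : ContractingWith (1 / 2) (simil i) :=
  ⟨by rw [← NNReal.coe_lt_coe]; norm_num, fun x y => (edist_simil i x y).le⟩

lemma tendsto_iterate_simil (i : Fin 3) (x : Plane) :
    Tendsto (fun n => (simil i)^[n] x) atTop (𝓝 (vertex i)) := by
  rw [(contractingWith_simil i).fixedPoint_unique (simil_vertex i)]
  exact (contractingWith_simil i).tendsto_iterate_fixedPoint x

lemma infDist_simil_le_half {i : Fin 3} {K : Set Plane} (hK : MapsTo (simil i) K K) (x : Plane) :
    Metric.infDist (simil i x) K ≤ Metric.infDist x K / 2 := by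
  rcases K.eq_empty_or_nonempty with rfl | hne
  · simp
  refine le_of_forall_pos_le_add fun ε hε => ?_
  obtain ⟨y, hy, hxy⟩ := (Metric.infDist_lt_iff hne).1 (lt_add_of_pos_right (Metric.infDist x K) hε)
  calc Metric.infDist (simil i x) K ≤ dist (simil i x) (simil i y) :=
        Metric.infDist_le_dist_of_mem (hK hy)
    _ ≤ Metric.infDist x K / 2 + ε := by rw [dist_simil]; linarith

lemma exists_pow_half_mul_mem_Icc {b r : ℝ} (hr : 0 < r) (hrb : r ≤ b) :
    ∃ k : ℕ, ∃ r' ∈ Icc (b / 2) b, r = (1 / 2) ^ k * r' := by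
  have hb : 0 < b := hr.trans_le hrb
  obtain ⟨k, hk, hk'⟩ := exists_nat_pow_near_of_lt_one (div_pos hr hb) ((div_le_one hb).2 hrb)
    (by norm_num : (0 : ℝ) < 1 / 2) (by norm_num)
  have hk0 : (0 : ℝ) < (1 / 2) ^ k := by positivity
  rw [lt_div_iff₀ hb, pow_succ] at hk
  rw [div_le_iff₀ hb] at hk'
  refine ⟨k, r / (1 / 2) ^ k, ⟨?_, ?_⟩, by field_simp⟩
  · rw [le_div_iff₀ hk0]; linarith
  · rw [div_le_iff₀ hk0]; linarith

lemma isCompact_gasket : IsCompact gasket := gasket_spec.2.1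

lemma isClosed_gasket : IsClosed gasket := isCompact_gasket.isClosed

lemma gasket_nonempty : gasket.Nonempty := gasket_spec.1

lemma simil_mem_gasket (i : Fin 3) {x : Plane} (hx : x ∈ gasket) : simil i x ∈ gasket := by
  rw [gasket_spec.2.2]
  exact mem_iUnion.2 ⟨i, mem_image_of_mem _ hx⟩

lemma exists_simil_eq {x : Plane} (hx : x ∈ gasket) : ∃ i, ∃ y ∈ gasket, simil i y = x := by
  rw [gasket_spec.2.2] at hx
  exact mem_iUnion.1 hx

lemma vertex_mem_gasket (i : Fin 3) : vertex i ∈ gasket := by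
  obtain ⟨x, hx⟩ := gasket_nonempty
  have h : MapsTo (simil i) gasket gasket := fun _ => simil_mem_gasket i
  exact isClosed_gasket.mem_of_tendsto (tendsto_iterate_simil i x)
    (Eventually.of_forall fun n => h.iterate n hx)

lemma gasket_subset_of_mapsTo {K : Set Plane} (hK : IsClosed K) (hne : K.Nonempty)
    (h : ∀ i, MapsTo (simil i) K K) : gasket ⊆ K := by
  obtain ⟨m, hm, hmax⟩ := isCompact_gasket.exists_isMaxOn gasket_nonempty
    (Metric.continuous_infDist_pt K).continuousOn
  obtain ⟨i, y, hy, rfl⟩ := exists_simil_eq hm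
  have h_half := infDist_simil_le_half (h i) y
  have h_max : Metric.infDist y K ≤ Metric.infDist (simil i y) K := hmax hy
  intro x hx
  have hx_max : Metric.infDist x K ≤ Metric.infDist (simil i y) K := hmax hx
  exact (hK.mem_iff_infDist_zero hne).2 (le_antisymm (by linarith) Metric.infDist_nonneg)

/-! ### Barycentric coordinates -/

/-- The barycentric coordinates with respect to the three vertices; they turn the geometry of the
gasket into linear inequalities. -/
def bary (i : Fin 3) (x : Plane) : ℝ :=
  ![1 - x 0 - x 1 / Real.sqrt 3, x 0 - x 1 / Real.sqrt 3, 2 * (x 1 / Real.sqrt 3)] i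

lemma continuous_bary (i : Fin 3) : Continuous (bary i) := by
  unfold bary
  fin_cases i
  · exact (by fun_prop : Continuous fun x : Plane => 1 - x 0 - x 1 / Real.sqrt 3)
  · exact (by fun_prop : Continuous fun x : Plane => x 0 - x 1 / Real.sqrt 3)
  · exact (by fun_prop : Continuous fun x : Plane => 2 * (x 1 / Real.sqrt 3))

lemma sum_bary (x : Plane) : bary 0 x + bary 1 x + bary 2 x = 1 := by
  simp [bary]; ring

lemma bary_simil (i j : Fin 3) (x : Plane) :
    bary j (simil i x) = bary j x / 2 + if i = j then 1 / 2 else 0 := by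
  have h : Real.sqrt 3 ≠ 0 := by positivity
  fin_cases i <;> fin_cases j <;> simp [bary, simil, vertex] <;> field_simp <;> ring

lemma bary_vertex (i j : Fin 3) : bary j (vertex i) = if i = j then 1 else 0 := by
  have h := bary_simil i j (vertex i)
  rw [simil_vertex] at h
  split_ifs at h ⊢ <;> linarith

lemma dist_sq_eq (x y : Plane) :
    dist x y ^ 2 = ((bary 0 x - bary 0 y) ^ 2 + (bary 1 x - bary 1 y) ^ 2
      + (bary 2 x - bary 2 y) ^ 2) / 2 := by
  have h_sqrt (t : ℝ) : t ^ 2 = 3 * (t / Real.sqrt 3) ^ 2 := by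
    rw [div_pow, Real.sq_sqrt (by norm_num)]; ring
  rw [EuclideanSpace.dist_eq, Real.sq_sqrt (by positivity)]
  simp only [Fin.sum_univ_two, Real.dist_eq, sq_abs, bary, Matrix.cons_val]
  rw [h_sqrt (x 1 - y 1)]
  ring

lemma ext_bary {x y : Plane} (h : ∀ i, bary i x = bary i y) : x = y := by
  have hd := dist_sq_eq x y
  rw [h 0, h 1, h 2] at hd
  simpa using hd

lemma bary_sub_sub_bary_sub_le (x y : Plane) (i j : Fin 3) :
    (bary i x - bary j x) - (bary i y - bary j y) ≤ 2 * dist x y := by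
  have key (c : Fin 3 → ℝ) : (c i - c j) ^ 2 ≤ 2 ^ 2 * ((c 0 ^ 2 + c 1 ^ 2 + c 2 ^ 2) / 2) := by
    fin_cases i <;> fin_cases j <;> simp <;>
      nlinarith [sq_nonneg (c 0 + c 1), sq_nonneg (c 0 + c 2), sq_nonneg (c 1 + c 2),
        sq_nonneg (c 0), sq_nonneg (c 1), sq_nonneg (c 2)]
  refine le_of_sq_le_sq ?_ (by positivity)
  rw [mul_pow, dist_sq_eq, sub_sub_sub_comm]
  exact key fun k => bary k x - bary k y

lemma sq_bary_sub_bary_le (x y : Plane) (k : Fin 3) :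
    3 / 4 * (bary k x - bary k y) ^ 2 ≤ dist x y ^ 2 := by
  have key (c : Fin 3 → ℝ) (hc : c 0 + c 1 + c 2 = 0) :
      3 / 4 * c k ^ 2 ≤ (c 0 ^ 2 + c 1 ^ 2 + c 2 ^ 2) / 2 := by
    have hc2 : c 2 = - c 0 - c 1 := by linarith
    fin_cases k <;> simp [hc2] <;>
      nlinarith [sq_nonneg (c 0 + 2 * c 1), sq_nonneg (2 * c 0 + c 1), sq_nonneg (c 0 - c 1)]
  rw [dist_sq_eq]
  exact key (fun k => bary k x - bary k y) (by linarith [sum_bary x, sum_bary y])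

lemma bary_nonneg {x : Plane} (hx : x ∈ gasket) (i : Fin 3) : 0 ≤ bary i x := by
  refine gasket_subset_of_mapsTo (K := {x | 0 ≤ bary i x})
    (isClosed_le continuous_const (continuous_bary i)) ⟨vertex 0, ?_⟩ (fun j y hy => ?_) hx
  · change 0 ≤ bary i (vertex 0)
    rw [bary_vertex]; positivity
  · change 0 ≤ bary i (simil j y)
    have hy : 0 ≤ bary i y := hy
    rw [bary_simil]; positivity

lemma bary_le_one {x : Plane} (hx : x ∈ gasket) (i : Fin 3) : bary i x ≤ 1 := by
  have hs := sum_bary x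
  have h0 := bary_nonneg hx 0
  have h1 := bary_nonneg hx 1
  have h2 := bary_nonneg hx 2
  fin_cases i <;> simp <;> linarith

lemma eq_vertex_of_bary_eq_one {x : Plane} (hx : x ∈ gasket) {i : Fin 3} (h : bary i x = 1) :
    x = vertex i := by
  have hs := sum_bary x
  have h0 := bary_nonneg hx 0
  have h1 := bary_nonneg hx 1
  have h2 := bary_nonneg hx 2
  refine ext_bary fun j => ?_
  rw [bary_vertex]
  fin_cases i <;> fin_cases j <;> simp at h ⊢ <;> linarith

lemma dist_le_one {x y : Plane} (hx : x ∈ gasket) (hy : y ∈ gasket) : dist x y ≤ 1 := by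
  have sq_sum_le {z : Plane} (hz : z ∈ gasket) :
      bary 0 z ^ 2 + bary 1 z ^ 2 + bary 2 z ^ 2 ≤ 1 := by
    have hsq (k) : bary k z ^ 2 ≤ bary k z :=
      (sq_le (bary_nonneg hz k) (bary_le_one hz k))
    linarith [hsq 0, hsq 1, hsq 2, sum_bary z]
  have hmul (k) : 0 ≤ bary k x * bary k y := mul_nonneg (bary_nonneg hx k) (bary_nonneg hy k)
  refine le_of_sq_le_sq ?_ zero_le_one
  rw [dist_sq_eq]
  linarith [sq_sum_le hx, sq_sum_le hy, hmul 0, hmul 1, hmul 2]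

lemma eq_vertex_of_simil_eq_simil {i j : Fin 3} (hij : i ≠ j) {x y : Plane} (hx : x ∈ gasket)
    (hy : y ∈ gasket) (h : simil i x = simil j y) : y = vertex i := by
  apply eq_vertex_of_bary_eq_one hy
  have hi := congrArg (bary i) h
  rw [bary_simil, bary_simil, if_pos rfl, if_neg hij.symm] at hi
  linarith [bary_nonneg hx i, bary_le_one hy i]

lemma eq_vertex_of_dist_simil_le {i l : Fin 3} (hil : i ≠ l) {y : Plane} (hy : y ∈ gasket)
    (h : dist (simil i y) (vertex l) ≤ 1 / 2) : y = vertex l := by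
  have hsq : dist (simil i y) (vertex l) ^ 2 ≤ (1 / 2) ^ 2 := by gcongr
  rw [dist_sq_eq] at hsq
  simp only [bary_simil, bary_vertex] at hsq
  refine eq_vertex_of_bary_eq_one hy (le_antisymm (bary_le_one hy l) ?_)
  have hs := sum_bary y
  have h0 := bary_nonneg hy 0
  have h1 := bary_nonneg hy 1
  have h2 := bary_nonneg hy 2
  fin_cases i <;> fin_cases l <;> simp at hsq hil ⊢ <;> nlinarith

lemma lt_dist_simil_simil_vertex {j l k : Fin 3} (hkj : k ≠ j) (hkl : k ≠ l) {y : Plane}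
    (hy : y ∈ gasket) : 2 / 5 < dist (simil k y) (simil j (vertex l)) := by
  have h := sq_bary_sub_bary_le (simil k y) (simil j (vertex l)) k
  simp only [bary_simil, bary_vertex, if_neg hkj.symm, if_neg hkl.symm, if_true] at h
  refine lt_of_pow_lt_pow_left₀ 2 dist_nonneg ?_
  nlinarith [bary_nonneg hy k]

/-! ### Feasible open sets and typical balls -/

lemma IsFeasible.gasket_subset_closure {O : Set Plane} (hO : IsFeasible O) : gasket ⊆ closure O :=
  gasket_subset_of_mapsTo isClosed_closure (hO.2.2.2.mono inter_subset_left).closure fun i =>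
    (mapsTo_iff_image_subset.2 (hO.2.1 i)).closure (continuous_simil i)

lemma IsFeasible.simil_notMem {O : Set Plane} (hO : IsFeasible O) {i j : Fin 3} (hij : i ≠ j)
    {y : Plane} (hy : y ∈ gasket) : simil i y ∉ simil j '' O := by
  have h_disj : Disjoint (simil j '' O) (closure (simil i '' O)) :=
    (hO.2.2.1 j i hij.symm).closure_right ((similHomeomorph j).isOpenMap O hO.1)
  refine fun h => Set.disjoint_left.1 h_disj h ?_
  exact image_closure_subset_closure_image (continuous_simil i)
    (mem_image_of_mem _ (hO.gasket_subset_closure hy))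

lemma IsTypical.map_simil {x : Plane} {d : ℝ} (h : IsTypical x d) (i : Fin 3) :
    IsTypical (simil i x) (d / 2) := by
  obtain ⟨hx, hd, O, hO, hB⟩ := h
  refine ⟨simil_mem_gasket i hx, half_pos hd, O, hO, ?_⟩
  rw [← image_simil_closedBall]
  exact (image_mono hB).trans (hO.2.1 i)

lemma IsTypical.map_iterate_simil {x : Plane} {d : ℝ} (h : IsTypical x d) (i : Fin 3) (n : ℕ) :
    IsTypical ((simil i)^[n] x) ((1 / 2) ^ n * d) := by
  induction n with
  | zero => simpa using h
  | succ n ih =>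
    rw [Function.iterate_succ_apply', pow_succ, mul_right_comm, mul_one_div]
    exact ih.map_simil i

lemma IsFeasible.eventually_isTypical {O : Set Plane} (hO : IsFeasible O) {x : Plane}
    (hx : x ∈ O ∩ gasket) : ∀ᶠ d in 𝓝[>] (0 : ℝ), IsTypical x d := by
  obtain ⟨ε, hε, hB⟩ := Metric.nhds_basis_closedBall.mem_iff.1 (hO.1.mem_nhds hx.1)
  filter_upwards [Ioc_mem_nhdsGT hε] with d hd
  exact ⟨hx.2, hd.1, O, hO, (Metric.closedBall_subset_closedBall hd.2).trans hB⟩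

/-- An open hexagon with the vertices of the gasket on its boundary; it is a feasible open set that
contains every other point of the gasket. -/
def hexagon : Set Plane := {x | ∀ i j, bary i x - bary j x < 1}

lemma isOpen_hexagon : IsOpen hexagon := by
  simp only [hexagon, ofPred_forall]
  exact isOpen_iInter_of_finite fun i => isOpen_iInter_of_finite fun j =>
    isOpen_lt ((continuous_bary i).sub (continuous_bary j)) continuous_const

lemma mem_hexagon_of_mem_gasket {x : Plane} (hx : x ∈ gasket) (h : ∀ i, x ≠ vertex i) :
    x ∈ hexagon := by
  intro i j
  have h_lt : bary i x < 1 :=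
    (bary_le_one hx i).lt_of_ne fun h_eq => h i (eq_vertex_of_bary_eq_one hx h_eq)
  linarith [bary_nonneg hx j]

lemma bary_simil_simil_sub_le {x : Plane} (hx : x ∈ gasket) {j l : Fin 3} (hjl : j ≠ l)
    (a b : Fin 3) : bary a (simil j (simil l x)) - bary b (simil j (simil l x)) ≤ 3 / 4 := by
  simp only [bary_simil]
  have hb := bary_nonneg hx b
  have ha := bary_le_one hx a
  split_ifs <;> first | linarith | exact absurd (by simp_all) hjl

lemma closedBall_subset_hexagon {x : Plane} (hx : x ∈ gasket) {j l : Fin 3} (hjl : j ≠ l)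
    {r : ℝ} (hr : r < 1 / 8) : Metric.closedBall (simil j (simil l x)) r ⊆ hexagon := by
  intro y hy a b
  have hy : dist y (simil j (simil l x)) ≤ r := hy
  linarith [bary_simil_simil_sub_le hx hjl a b,
    bary_sub_sub_bary_sub_le y (simil j (simil l x)) a b]

lemma isFeasible_hexagon : IsFeasible hexagon := by
  refine ⟨isOpen_hexagon, ?_, fun i j hij => Set.disjoint_left.2 ?_, ?_⟩
  · rintro i _ ⟨x, hx, rfl⟩ a b
    simp only [bary_simil]
    split_ifs with hia hib hib
    · linarith [hx a b]
    · subst hia; linarith [hx i b, hx b i]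
    · linarith [hx a b, hx i a]
    · linarith [hx a b]
  · rintro _ ⟨x, hx, rfl⟩ ⟨y, hy, hxy⟩
    have hi := congrArg (bary i) hxy
    have hj := congrArg (bary j) hxy
    simp only [bary_simil, if_pos, if_neg hij, if_neg hij.symm] at hi hj
    linarith [hx j i, hy i j]
  · have h_ne : (0 : Fin 3) ≠ 1 := by decide
    exact ⟨simil 0 (simil 1 (vertex 0)),
      closedBall_subset_hexagon (vertex_mem_gasket 0) h_ne (r := 0) (by norm_num) (by simp),
      simil_mem_gasket _ (simil_mem_gasket _ (vertex_mem_gasket 0))⟩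

lemma isTypical_simil_simil {x : Plane} (hx : x ∈ gasket) {j l : Fin 3} (hjl : j ≠ l)
    {r : ℝ} (hr₀ : 0 < r) (hr : r < 1 / 8) : IsTypical (simil j (simil l x)) r :=
  ⟨simil_mem_gasket _ (simil_mem_gasket _ hx), hr₀, hexagon, isFeasible_hexagon,
    closedBall_subset_hexagon hx hjl hr⟩

/-- The power `(2d)^s` of the diameter of a ball of radius `d`, where `s` is the similarity
dimension, as an extended nonnegative real. -/
def diamPow (d : ℝ) : ℝ≥0∞ := ENNReal.ofReal ((2 * d) ^ dimS)

lemma two_rpow_dimS : (2 : ℝ) ^ dimS = 3 :=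
  Real.rpow_logb (by norm_num) (by norm_num) (by norm_num)

lemma one_le_dimS : 1 ≤ dimS :=
  (one_le_div (Real.log_pos one_lt_two)).2 (Real.log_le_log two_pos (by norm_num))

lemma dimS_pos : 0 < dimS := zero_lt_one.trans_le one_le_dimS

lemma ofReal_half_rpow_dimS : ENNReal.ofReal ((1 / 2 : ℝ) ^ dimS) = 3⁻¹ := by
  rw [Real.div_rpow zero_le_one zero_le_two, two_rpow_dimS, Real.one_rpow, one_div,
    ENNReal.ofReal_inv_of_pos three_pos, ENNReal.ofReal_ofNat]

lemma diamPow_one : diamPow 1 = 3 := by simp [diamPow, two_rpow_dimS]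

lemma diamPow_half {d : ℝ} (hd : 0 ≤ d) : diamPow (d / 2) = 3⁻¹ * diamPow d := by
  rw [diamPow, diamPow, ← ofReal_half_rpow_dimS, ← ENNReal.ofReal_mul (by positivity),
    ← Real.mul_rpow (by norm_num) (by positivity)]
  congr 2
  ring

lemma diamPow_ne_zero {d : ℝ} (hd : 0 < d) : diamPow d ≠ 0 :=
  (ENNReal.ofReal_pos.2 (by positivity)).ne'

lemma diamPow_ne_top (d : ℝ) : diamPow d ≠ ⊤ := ENNReal.ofReal_ne_top

lemma continuous_diamPow : Continuous diamPow :=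
  ENNReal.continuous_ofReal.comp
    ((continuous_const.mul continuous_id).rpow_const fun _ => Or.inr dimS_pos.le)

lemma diamPow_mono {a b : ℝ} (ha : 0 ≤ a) (h : a ≤ b) : diamPow a ≤ diamPow b :=
  ENNReal.ofReal_le_ofReal (Real.rpow_le_rpow (by positivity) (by linarith) dimS_pos.le)

lemma density_eq_div_diamPow (α : Set Plane → ℝ≥0∞) (x : Plane) (d : ℝ) :
    density α x d = α (Metric.closedBall x d) / diamPow d := rfl

lemma density_half {α : Set Plane → ℝ≥0∞} {x y : Plane} {d : ℝ} (hd : 0 ≤ d)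
    (h : α (Metric.closedBall x (d / 2)) = 3⁻¹ * α (Metric.closedBall y d)) :
    density α x (d / 2) = density α y d := by
  rw [density_eq_div_diamPow, density_eq_div_diamPow, h, diamPow_half hd]
  exact ENNReal.mul_div_mul_left _ _ (by simp) (by simp)

lemma density_le_density_half {α : Set Plane → ℝ≥0∞} {x y : Plane} {d : ℝ} (hd : 0 ≤ d)
    (h : 3⁻¹ * α (Metric.closedBall y d) ≤ α (Metric.closedBall x (d / 2))) :
    density α y d ≤ density α x (d / 2) := by
  rw [density_eq_div_diamPow, density_eq_div_diamPow, diamPow_half hd,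
    ← ENNReal.mul_div_mul_left (α (Metric.closedBall y d)) _ (c := 3⁻¹) (by simp) (by simp)]
  gcongr

lemma subsingleton_of_mapsTo_of_dist_eq_two_mul {X : Type*} [MetricSpace X] {M : Set X}
    (hM : M.Finite) {g : X → X} (hg : MapsTo g M M) (h : ∀ x y, dist (g x) (g y) = 2 * dist x y) :
    M.Subsingleton := by
  intro x hx y hy
  obtain ⟨p, hp, hmax⟩ := exists_max_image (M ×ˢ M) (fun p => dist p.1 p.2) (hM.prod hM)
    ⟨(x, y), hx, hy⟩
  have hgp := hmax (g p.1, g p.2) ⟨hg hp.1, hg hp.2⟩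
  rw [h] at hgp
  have hxy : dist x y ≤ dist p.1 p.2 := hmax (x, y) ⟨hx, hy⟩
  exact dist_le_zero.1 (by linarith)

lemma exists_isMax_measure {X ι : Type*} [MeasurableSpace X] (μ : Measure X) [IsFiniteMeasure μ]
    {A : ι → Set X} (hA : ∀ a, NullMeasurableSet (A a) μ)
    (hd : Pairwise (Function.onFun (AEDisjoint μ) A)) {a₀ : ι} (ha₀ : μ (A a₀) ≠ 0) :
    ∃ b, (∀ a, μ (A a) ≤ μ (A b)) ∧ {a | μ (A a) = μ (A b)}.Finite := by
  have hfin : {a | μ (A a₀) ≤ μ (A a)}.Finite :=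
    Measure.finite_const_le_meas_of_disjoint_iUnion₀ μ (pos_iff_ne_zero.2 ha₀) hA hd
      (measure_ne_top μ _)
  obtain ⟨b, hb, hmax⟩ := exists_max_image _ (fun a => μ (A a)) hfin ⟨a₀, le_refl (μ (A a₀))⟩
  refine ⟨b, fun a => ?_, hfin.subset fun a ha => (mem_ofPred.1 hb).trans_eq (Eq.symm ha)⟩
  rcases le_total (μ (A a₀)) (μ (A a)) with h | h
  · exact hmax a h
  · exact h.trans hb

lemma finite_inter_sphere {V P : Type*} [NormedAddCommGroup V] [InnerProductSpace ℝ V]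
    [MetricSpace P] [NormedAddTorsor V P] (hV : Module.finrank ℝ V = 2) {c₁ c₂ : P} {r₁ r₂ : ℝ}
    (h : (c₁, r₁) ≠ (c₂, r₂)) : (Metric.sphere c₁ r₁ ∩ Metric.sphere c₂ r₂).Finite := by
  have : FiniteDimensional ℝ V := Module.finite_of_finrank_eq_succ hV
  by_cases hc : c₁ = c₂
  · subst hc
    convert Set.finite_empty
    refine eq_empty_iff_forall_notMem.2 fun x hx => h ?_
    rw [← hx.1, ← hx.2]
  by_cases hs : (Metric.sphere c₁ r₁ ∩ Metric.sphere c₂ r₂).Subsingleton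
  · exact hs.finite
  obtain ⟨p₁, h₁, p₂, h₂, hp⟩ := not_subsingleton_iff.1 hs
  exact (Set.toFinite {p₁, p₂}).subset fun p hp' =>
    EuclideanGeometry.eq_of_dist_eq_of_dist_eq_of_finrank_eq_two hV hc hp h₁.1 h₂.1 hp'.1
      h₁.2 h₂.2 hp'.2

lemma continuousAt_measure_closedBall {X : Type*} [PseudoMetricSpace X] [MeasurableSpace X]
    [OpensMeasurableSpace X] {μ : Measure X} [IsFiniteMeasure μ] {x : X} {d : ℝ}
    (h : μ (Metric.sphere x d) = 0) :
    ContinuousAt (fun p : X × ℝ => μ (Metric.closedBall p.1 p.2)) (x, d) := by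
  refine tendsto_measure_of_ae_tendsto_indicator_of_isFiniteMeasure _
    Metric.isClosed_closedBall.measurableSet (fun p => Metric.isClosed_closedBall.measurableSet) ?_
  filter_upwards [measure_eq_zero_iff_ae_notMem.1 h] with y hy
  have hc : Continuous fun p : X × ℝ => dist y p.1 - p.2 := by fun_prop
  rcases lt_or_gt_of_ne (hy : dist y x ≠ d) with hlt | hgt
  · filter_upwards [(hc.tendsto (x, d)).eventually_lt_const (sub_neg.2 hlt)] with p hp
    exact iff_of_true (sub_neg.1 hp).le hlt.le
  · filter_upwards [(hc.tendsto (x, d)).eventually_const_lt (sub_pos.2 hgt)] with p hp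
    exact iff_of_false (sub_pos.1 hp).not_ge hgt.not_ge

/-! ### Self-similar measures -/

/-- The nonzero finite measures on the gasket that are fixed by the Markov operator of the system
with equal weights `1/3`. -/
structure IsSelfSimilar (ν : Measure Plane) : Prop where
  isFiniteMeasure : IsFiniteMeasure ν
  measure_compl : ν gasketᶜ = 0
  measure_pos : 0 < ν gasket
  eq_sum : ν = ∑ i : Fin 3, (3⁻¹ : ℝ≥0∞) • ν.map (simil i)

namespace IsSelfSimilar

variable {ν : Measure Plane}

lemma measure_eq (hν : IsSelfSimilar ν) {A : Set Plane} (hA : MeasurableSet A) :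
    ν A = 3⁻¹ * ∑ i, ν (simil i ⁻¹' A) := by
  conv_lhs => rw [hν.eq_sum]
  rw [Measure.finsetSum_apply, Finset.mul_sum]
  refine Finset.sum_congr rfl fun i _ => ?_
  rw [Measure.smul_apply, Measure.map_apply (continuous_simil i).measurable hA, smul_eq_mul]

lemma measure_inter_gasket (hν : IsSelfSimilar ν) (A : Set Plane) : ν (A ∩ gasket) = ν A :=
  measure_inter_conull hν.measure_compl

lemma le_measure_gasket (hν : IsSelfSimilar ν) (A : Set Plane) : ν A ≤ ν gasket := by
  rw [← hν.measure_inter_gasket]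
  exact measure_mono inter_subset_right

lemma measure_ne_top (hν : IsSelfSimilar ν) (A : Set Plane) : ν A ≠ ⊤ :=
  haveI := hν.isFiniteMeasure
  MeasureTheory.measure_ne_top ν A

lemma inv_three_mul_le (hν : IsSelfSimilar ν) {A : Set Plane} (hA : MeasurableSet A)
    (i : Fin 3) : 3⁻¹ * ν (simil i ⁻¹' A) ≤ ν A := by
  rw [hν.measure_eq hA]
  gcongr
  exact Finset.single_le_sum (f := fun i => ν (simil i ⁻¹' A)) (fun _ _ => zero_le)
    (Finset.mem_univ i)

lemma inv_three_mul_measure_closedBall_le (hν : IsSelfSimilar ν) (i : Fin 3) (x : Plane) (d : ℝ) :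
    3⁻¹ * ν (Metric.closedBall x d) ≤ ν (Metric.closedBall (simil i x) (d / 2)) := by
  rw [← preimage_simil_closedBall i x d]
  exact hν.inv_three_mul_le Metric.isClosed_closedBall.measurableSet i

lemma measure_preimage_simil_eq (hν : IsSelfSimilar ν) {A : Set Plane} (hA : MeasurableSet A)
    (hle : ∀ i, ν (simil i ⁻¹' A) ≤ ν A) (i : Fin 3) : ν (simil i ⁻¹' A) = ν A := by
  have h_sum : ∑ j, (ν (simil j ⁻¹' A)).toReal = ∑ _j : Fin 3, (ν A).toReal := by
    have h := congrArg ENNReal.toReal (hν.measure_eq hA)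
    rw [ENNReal.toReal_mul, ENNReal.toReal_sum fun i _ => hν.measure_ne_top _] at h
    simp only [Fin.sum_const, h, ENNReal.toReal_inv, ENNReal.toReal_ofNat, nsmul_eq_mul]
    push_cast
    ring
  have h_le (j : Fin 3) : (ν (simil j ⁻¹' A)).toReal ≤ (ν A).toReal :=
    ENNReal.toReal_mono (hν.measure_ne_top _) (hle j)
  exact (ENNReal.toReal_eq_toReal_iff' (hν.measure_ne_top _) (hν.measure_ne_top _)).1
    ((Finset.sum_eq_sum_iff_of_le fun j _ => h_le j).1 h_sum i (Finset.mem_univ i))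

lemma exists_finite_invariant (hν : IsSelfSimilar ν) {ι : Type*} {A : ι → Set Plane}
    (hA : ∀ a, MeasurableSet (A a)) (hd : Pairwise (Function.onFun (AEDisjoint ν) A))
    {g : Fin 3 → ι → ι} (hg : ∀ i a, simil i ⁻¹' A a = A (g i a)) {a₀ : ι} (ha₀ : ν (A a₀) ≠ 0) :
    ∃ M : Set ι, M.Finite ∧ M.Nonempty ∧ ∀ i, MapsTo (g i) M M := by
  have := hν.isFiniteMeasure
  obtain ⟨b, hmax, hfin⟩ := exists_isMax_measure ν (fun a => (hA a).nullMeasurableSet) hd ha₀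
  refine ⟨_, hfin, ⟨b, rfl⟩, fun i a ha => ?_⟩
  have ha : ν (A a) = ν (A b) := ha
  have h_pre := hν.measure_preimage_simil_eq (hA a) (fun j => by rw [hg, ha]; exact hmax _) i
  rwa [hg, ha] at h_pre

lemma measure_singleton (hν : IsSelfSimilar ν) (x : Plane) : ν {x} = 0 := by
  by_contra h
  obtain ⟨M, hfin, ⟨m, hm⟩, hM⟩ := hν.exists_finite_invariant (A := fun x : Plane => {x})
    (g := fun i => (similHomeomorph i).symm) measurableSet_singleton
    (fun a b hab => (disjoint_singleton.2 hab).aedisjoint)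
    (fun i x => Set.ext fun _ => (similHomeomorph i).eq_symm_apply.symm) h
  have h_eq (i : Fin 3) : m = vertex i := by
    have h_fix : (similHomeomorph i).symm m = m :=
      subsingleton_of_mapsTo_of_dist_eq_two_mul hfin (hM i) (dist_similHomeomorph_symm i) (hM i hm)
        hm
    have h_dist := dist_simil_vertex i m
    rw [← h_fix, simil_similHomeomorph_symm, h_fix] at h_dist
    exact dist_le_zero.1 (by linarith)
  have h_bary := congrArg (bary 0) ((h_eq 0).symm.trans (h_eq 1))
  simp [bary_vertex] at h_bary

lemma measure_eq_zero_of_inter_subset (hν : IsSelfSimilar ν) {A : Set Plane} {p : Plane}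
    (h : A ∩ gasket ⊆ {p}) : ν A = 0 := by
  rw [← hν.measure_inter_gasket]
  exact measure_mono_null h (hν.measure_singleton p)

lemma measure_eq_zero_of_disjoint (hν : IsSelfSimilar ν) {A : Set Plane}
    (h : Disjoint A gasket) : ν A = 0 :=
  measure_mono_null h.subset_compl_right hν.measure_compl

lemma measure_sphere (hν : IsSelfSimilar ν) (x : Plane) {r : ℝ} (hr : 0 < r) :
    ν (Metric.sphere x r) = 0 := by
  have : NullSingletonClass ν := ⟨hν.measure_singleton⟩
  by_contra h
  obtain ⟨M, hfin, hne, hM⟩ := hν.exists_finite_invariant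
    (A := fun p : Plane × Ioi (0 : ℝ) => Metric.sphere p.1 p.2)
    (g := fun i p => ((similHomeomorph i).symm p.1, ⟨2 * p.2, mem_Ioi.2 (mul_pos two_pos p.2.2)⟩))
    (fun p => Metric.isClosed_sphere.measurableSet)
    (fun a b hab => (finite_inter_sphere (by simp : Module.finrank ℝ Plane = 2)
      fun h_eq => hab (Prod.ext (congrArg (·.1) h_eq)
        (Subtype.ext (congrArg (·.2) h_eq)))).measure_zero ν)
    (fun i p => by
      ext y
      have h_dist := dist_simil i y ((similHomeomorph i).symm p.1)
      rw [simil_similHomeomorph_symm] at h_dist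
      rw [mem_preimage, Metric.mem_sphere, Metric.mem_sphere, h_dist, div_eq_iff two_ne_zero,
        mul_comm])
    (a₀ := (x, ⟨r, hr⟩)) h
  obtain ⟨m, hm, hmax⟩ := exists_max_image M (fun p => (p.2 : ℝ)) hfin hne
  have h_two : 2 * (m.2 : ℝ) ≤ m.2 := hmax _ (hM 0 hm)
  linarith [show (0 : ℝ) < m.2 from m.2.2]

lemma continuousAt_density (hν : IsSelfSimilar ν) (x : Plane) {d : ℝ} (hd : 0 < d) :
    ContinuousAt (fun p : Plane × ℝ => density ν p.1 p.2) (x, d) :=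
  haveI := hν.isFiniteMeasure
  ENNReal.Tendsto.div (continuousAt_measure_closedBall (hν.measure_sphere x hd))
    (Or.inr (diamPow_ne_zero hd)) (continuous_diamPow.comp continuous_snd).continuousAt
    (Or.inl (diamPow_ne_top _))

lemma continuousOn_density (hν : IsSelfSimilar ν) (x : Plane) :
    ContinuousOn (fun d : ℝ => density ν x d) (Ioi 0) := fun d hd =>
  (ContinuousAt.comp (f := fun d : ℝ => (x, d)) (hν.continuousAt_density x hd)
    (by fun_prop)).continuousWithinAt

lemma density_le_density_simil (hν : IsSelfSimilar ν) {x : Plane} {d : ℝ} (hd : 0 ≤ d)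
    (j : Fin 3) : density ν x d ≤ density ν (simil j x) (d / 2) :=
  density_le_density_half hd (hν.inv_three_mul_measure_closedBall_le j x d)

lemma inv_three_mul_measure_gasket_le (hν : IsSelfSimilar ν) {x : Plane}
    (hx : x ∈ gasket) : 3⁻¹ * ν gasket ≤ ν (Metric.closedBall x (1 / 2)) := by
  obtain ⟨i, y, hy, rfl⟩ := exists_simil_eq hx
  refine le_trans ?_ (hν.inv_three_mul_measure_closedBall_le i y 1)
  gcongr
  exact fun z hz => dist_le_one hz hy

lemma le_density (hν : IsSelfSimilar ν) {x : Plane} (hx : x ∈ gasket) {d : ℝ} (hd : 0 < d)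
    (hd₁ : d ≤ 1) : 3⁻¹ * ν gasket / 3 ≤ density ν x d := by
  obtain ⟨k, r, hr, rfl⟩ := exists_pow_half_mul_mem_Icc hd hd₁
  clear hd hd₁
  have hr₀ : 0 < r := by linarith [hr.1]
  induction k generalizing x with
  | zero =>
    rw [pow_zero, one_mul]
    calc 3⁻¹ * ν gasket / 3 = 3⁻¹ * ν gasket / diamPow 1 := by rw [diamPow_one]
      _ ≤ ν (Metric.closedBall x (1 / 2)) / diamPow r :=
        ENNReal.div_le_div (hν.inv_three_mul_measure_gasket_le hx) (diamPow_mono hr₀.le hr.2)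
      _ ≤ density ν x r :=
        ENNReal.div_le_div_right (measure_mono (Metric.closedBall_subset_closedBall hr.1)) _
  | succ k ih =>
    obtain ⟨i, y, hy, rfl⟩ := exists_simil_eq hx
    rw [pow_succ, mul_right_comm, mul_one_div]
    exact (ih hy).trans (hν.density_le_density_simil (by positivity) i)

lemma measure_closedBall_pos (hν : IsSelfSimilar ν) {x : Plane} (hx : x ∈ gasket) {d : ℝ}
    (hd : 0 < d) : 0 < ν (Metric.closedBall x d) := by
  have h_pos : 0 < density ν x (min d 1) :=
    (ENNReal.div_pos (mul_ne_zero (by simp) hν.measure_pos.ne') (by simp)).trans_le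
      (hν.le_density hx (by positivity) (min_le_right d 1))
  exact (ENNReal.div_pos_iff.1 h_pos).1.bot_lt.trans_le
    (measure_mono (Metric.closedBall_subset_closedBall (min_le_left d 1)))

lemma density_pos (hν : IsSelfSimilar ν) {x : Plane} (hx : x ∈ gasket) {d : ℝ} (hd : 0 < d) :
    0 < density ν x d :=
  ENNReal.div_pos (hν.measure_closedBall_pos hx hd).ne' (diamPow_ne_top d)

lemma density_ne_top (hν : IsSelfSimilar ν) {x : Plane} {d : ℝ} (hd : 0 < d) :
    density ν x d ≠ ⊤ :=
  ENNReal.div_ne_top (hν.measure_ne_top _) (diamPow_ne_zero hd)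

lemma measure_closedBall_simil (hν : IsSelfSimilar ν) {j : Fin 3} {x : Plane} {d : ℝ}
    (h : ∀ i ≠ j, ν (simil i ⁻¹' Metric.closedBall (simil j x) (d / 2)) = 0) :
    ν (Metric.closedBall (simil j x) (d / 2)) = 3⁻¹ * ν (Metric.closedBall x d) := by
  rw [hν.measure_eq Metric.isClosed_closedBall.measurableSet,
    Finset.sum_eq_single j (fun i _ hi => h i hi) (by simp), preimage_simil_closedBall]

lemma density_simil_of_isTypical (hν : IsSelfSimilar ν) {x : Plane} {d : ℝ}
    (h : IsTypical x d) (j : Fin 3) : density ν (simil j x) (d / 2) = density ν x d := by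
  obtain ⟨-, hd, O, hO, hB⟩ := h
  refine density_half hd.le (hν.measure_closedBall_simil fun i hi => ?_)
  refine hν.measure_eq_zero_of_disjoint (Set.disjoint_left.2 fun y hy hyS => ?_)
  rw [mem_preimage, ← image_simil_closedBall] at hy
  exact hO.simil_notMem hi hyS (image_mono hB hy)

lemma density_iterate_simil_of_isTypical (hν : IsSelfSimilar ν) {x : Plane} {d : ℝ}
    (h : IsTypical x d) (i : Fin 3) (n : ℕ) :
    density ν ((simil i)^[n] x) ((1 / 2) ^ n * d) = density ν x d := by
  induction n with
  | zero => simp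
  | succ n ih =>
    rw [Function.iterate_succ_apply', pow_succ, mul_right_comm, mul_one_div,
      hν.density_simil_of_isTypical (h.map_iterate_simil i n), ih]

lemma measure_closedBall_simil_of_le_one (hν : IsSelfSimilar ν) {l : Fin 3} {x : Plane} {d : ℝ}
    (h : dist x (vertex l) + d ≤ 1) :
    ν (Metric.closedBall (simil l x) (d / 2)) = 3⁻¹ * ν (Metric.closedBall x d) := by
  refine hν.measure_closedBall_simil fun i hi => ?_
  refine hν.measure_eq_zero_of_inter_subset (p := vertex l) fun y ⟨hy, hyS⟩ => ?_
  refine eq_vertex_of_dist_simil_le hi hyS ?_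
  have hy : dist (simil i y) (simil l x) ≤ d / 2 := hy
  linarith [dist_triangle (simil i y) (simil l x) (vertex l), dist_simil_vertex l x]

lemma measure_closedBall_junction (hν : IsSelfSimilar ν) {j l : Fin 3} (hjl : j ≠ l)
    {x x' : Plane} {r : ℝ} (hxx' : simil j x = simil l x')
    (h : dist (simil j x) (simil j (vertex l)) + r / 2 ≤ 2 / 5) :
    ν (Metric.closedBall (simil j x) (r / 2))
      = 3⁻¹ * (ν (Metric.closedBall x r) + ν (Metric.closedBall x' r)) := by
  rw [hν.measure_eq Metric.isClosed_closedBall.measurableSet,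
    Fintype.sum_eq_add j l hjl fun k hk => ?_, preimage_simil_closedBall, hxx',
    preimage_simil_closedBall]
  refine hν.measure_eq_zero_of_disjoint (Set.disjoint_left.2 fun z hz hzS => ?_)
  have hz : dist (simil k z) (simil j x) ≤ r / 2 := hz
  linarith [dist_triangle (simil k z) (simil j x) (simil j (vertex l)),
    lt_dist_simil_simil_vertex hk.1 hk.2 hzS]

-- The ball meets the two pieces at the junction `simil j (vertex l) = simil l (vertex j)`, and the
-- homothety about the junction acts on either piece like the similitude fixing the vertex there.
lemma density_junction (hν : IsSelfSimilar ν) {j l : Fin 3} (hjl : j ≠ l) {x : Plane} {r : ℝ}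
    (hr : 0 ≤ r) (h : dist x (vertex l) / 2 + r ≤ 2 / 5) :
    density ν (simil j (simil l x)) (r / 2) = density ν (simil j x) r := by
  obtain ⟨x', hx'⟩ := surjective_simil l (simil j x)
  have hx'_eq : x' = x + vertex j - vertex l := by
    rw [← sub_eq_zero] at hx' ⊢
    rw [← smul_eq_zero_iff_right (show (1 / 2 : ℝ) ≠ 0 by norm_num), ← hx']
    simp only [simil]; module
  have hsimil : simil j (simil l x) = simil l (simil j x') := by
    rw [hx'_eq]; simp only [simil]; module
  have hdist : dist x' (vertex j) = dist x (vertex l) := by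
    rw [hx'_eq, dist_eq_norm, dist_eq_norm]; congr 1; abel
  have hj := dist_simil j x (vertex l)
  have hjl' := dist_simil j (simil l x) (vertex l)
  have hl := dist_simil_vertex l x
  have : 0 ≤ dist x (vertex l) := dist_nonneg
  have h_fine := hν.measure_closedBall_junction hjl hsimil (r := r) (by linarith)
  have h_coarse := hν.measure_closedBall_junction hjl hx'.symm (r := 2 * r) (by linarith)
  have hr2 : r = 2 * r / 2 := by ring
  refine density_half hr ?_
  rw [h_fine]
  nth_rw 3 [hr2]
  rw [h_coarse, hr2, hν.measure_closedBall_simil_of_le_one (by linarith),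
    hν.measure_closedBall_simil_of_le_one (by linarith), ← hr2, mul_add, mul_add, mul_add]

end IsSelfSimilar

/-- A compact set of pairs `(x, d)` such that `B(x,d)` is typical; the balls centred in the six
pieces `fⱼ(fₗ(S))` with `j ≠ l` and of radius in `[1/20, 1/10]` realize all the densities of
typical balls. -/
def coreBalls : Set (Plane × ℝ) :=
  (⋃ p : {p : Fin 3 × Fin 3 // p.1 ≠ p.2}, simil p.1.1 '' (simil p.1.2 '' gasket)) ×ˢ
    Icc (1 / 20) (1 / 10)

lemma isCompact_coreBalls : IsCompact coreBalls :=
  (isCompact_iUnion fun _ => (isCompact_gasket.image (continuous_simil _)).image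
    (continuous_simil _)).prod isCompact_Icc

lemma mem_coreBalls {j l : Fin 3} (hjl : j ≠ l) {x : Plane} (hx : x ∈ gasket) {r : ℝ}
    (hr : r ∈ Icc (1 / 20 : ℝ) (1 / 10)) : (simil j (simil l x), r) ∈ coreBalls :=
  ⟨mem_iUnion.2 ⟨⟨(j, l), hjl⟩, mem_image_of_mem _ (mem_image_of_mem _ hx)⟩, hr⟩

lemma isTypical_of_mem_coreBalls {p : Plane × ℝ} (hp : p ∈ coreBalls) : IsTypical p.1 p.2 := by
  obtain ⟨hp₁, hp₂⟩ := hp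
  obtain ⟨⟨⟨j, l⟩, hjl⟩, _, ⟨x, hx, rfl⟩, h⟩ := mem_iUnion.1 hp₁
  rw [← h]
  exact isTypical_simil_simil hx hjl (by linarith [hp₂.1]) (by linarith [hp₂.2])

namespace IsSelfSimilar

variable {ν : Measure Plane}

-- Write `x = f_i(y)`. If `i = l`, the ball is halved towards a junction point; otherwise it is the
-- image of a typical ball. Either way its density is that of a ball of twice the radius.
lemma density_mem_image_coreBalls (hν : IsSelfSimilar ν) {j l : Fin 3} (hjl : j ≠ l) {x : Plane}
    (hx : x ∈ gasket) {r : ℝ} (hr : 0 < r) (hr' : r ≤ 1 / 10) :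
    density ν (simil j (simil l x)) r ∈ (fun p : Plane × ℝ => density ν p.1 p.2) '' coreBalls := by
  obtain ⟨k, r, hmem, rfl⟩ := exists_pow_half_mul_mem_Icc hr hr'
  clear hr hr'
  have hr₀ : 0 < r := by linarith [hmem.1]
  induction k generalizing j l x with
  | zero =>
    rw [pow_zero, one_mul]
    exact ⟨_, mem_coreBalls hjl hx ⟨by linarith [hmem.1], hmem.2⟩, rfl⟩
  | succ k ih =>
    obtain ⟨i, y, hy, rfl⟩ := exists_simil_eq hx
    have h_pos : 0 < (1 / 2 : ℝ) ^ k * r := by positivity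
    have h_le : (1 / 2 : ℝ) ^ k * r ≤ 1 / 10 :=
      (mul_le_of_le_one_left hr₀.le (pow_le_one₀ (by norm_num) (by norm_num))).trans hmem.2
    rw [pow_succ, mul_right_comm, mul_one_div]
    by_cases hli : l = i
    · subst hli
      have h_dist : dist (simil l y) (vertex l) ≤ 1 / 2 := by
        linarith [dist_simil_vertex l y, dist_le_one hy (vertex_mem_gasket l)]
      rw [hν.density_junction hjl h_pos.le (by linarith)]
      exact ih hjl hy
    · rw [hν.density_simil_of_isTypical (isTypical_simil_simil hy hli h_pos (by linarith))]
      exact ih hli hy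

lemma typicalDensities_eq_image (hν : IsSelfSimilar ν) :
    typicalDensities ν = (fun p : Plane × ℝ => density ν p.1 p.2) '' coreBalls := by
  apply subset_antisymm
  · rintro _ ⟨x, d, h, rfl⟩
    obtain ⟨n, hn⟩ := exists_pow_lt_of_lt_one (div_pos (by norm_num : (0 : ℝ) < 2 / 5) h.2.1)
      (by norm_num : (1 / 2 : ℝ) < 1)
    rw [lt_div_iff₀ h.2.1] at hn
    have h_small := h.map_iterate_simil 1 n
    have h_pos := h_small.2.1
    rw [← hν.density_iterate_simil_of_isTypical h 1 n,
      ← hν.density_simil_of_isTypical h_small 1,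
      ← hν.density_simil_of_isTypical (h_small.map_simil 1) 0]
    exact hν.density_mem_image_coreBalls (by decide) h_small.1 (by positivity) (by linarith)
  · rintro _ ⟨p, hp, rfl⟩
    exact ⟨p.1, p.2, isTypical_of_mem_coreBalls hp, rfl⟩

lemma isCompact_typicalDensities (hν : IsSelfSimilar ν) : IsCompact (typicalDensities ν) := by
  rw [hν.typicalDensities_eq_image]
  refine isCompact_coreBalls.image_of_continuousOn fun p hp => ?_
  exact (hν.continuousAt_density p.1 (isTypical_of_mem_coreBalls hp).2.1).continuousWithinAt

lemma density_le_of_mem_upperBounds (hν : IsSelfSimilar ν) {b : ℝ≥0∞}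
    (hb : b ∈ upperBounds (typicalDensities ν)) {x : Plane} (hx : x ∈ gasket) {d : ℝ}
    (hd : 0 < d) (hd' : d ≤ 2 / 5) : density ν x d ≤ b :=
  (hν.density_le_density_simil hd.le 1).trans <|
    (hν.density_le_density_simil (half_pos hd).le 0).trans <|
      hb ⟨_, _, isTypical_simil_simil hx (by decide) (by positivity) (by linarith), rfl⟩

end IsSelfSimilar

lemma typicalDensities_nonempty (α : Set Plane → ℝ≥0∞) : (typicalDensities α).Nonempty :=
  ⟨_, _, _, isTypical_simil_simil (vertex_mem_gasket 0) (by decide : (0 : Fin 3) ≠ 1)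
    (r := 1 / 10) (by norm_num) (by norm_num), rfl⟩

/-! ### Uniqueness of scaling set functions -/

/-- A set function on the plane that is monotone, finitely subadditive on closed sets, finite on the
gasket, and multiplied by at most `3⁻¹` under each similitude. These properties determine its values
on the traces of balls up to a constant factor. -/
structure IsScaling (β : Set Plane → ℝ≥0∞) : Prop where
  mono : ∀ A B, A ⊆ B → β A ≤ β B
  union_le : ∀ A B, IsClosed A → IsClosed B → β (A ∪ B) ≤ β A + β B
  image_le : ∀ i A, IsClosed A → A ⊆ gasket → β (simil i '' A) ≤ 3⁻¹ * β A
  ne_top : β gasket ≠ ⊤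

namespace IsScaling

variable {β : Set Plane → ℝ≥0∞} {ν : Measure Plane}

lemma empty (hβ : IsScaling β) : β ∅ = 0 := by
  have h_le := hβ.image_le 0 ∅ isClosed_empty (empty_subset _)
  have h_top : β ∅ ≠ ⊤ := ne_top_of_le_ne_top hβ.ne_top (hβ.mono _ _ (empty_subset _))
  rw [image_empty, ← ENNReal.toReal_le_toReal h_top (ENNReal.mul_ne_top (by simp) h_top),
    ENNReal.toReal_mul, ENNReal.toReal_inv, ENNReal.toReal_ofNat] at h_le
  refine (ENNReal.toReal_eq_zero_iff _).1 ?_ |>.resolve_right h_top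
  linarith [ENNReal.toReal_nonneg (a := β ∅)]

lemma le_sum_preimage (hβ : IsScaling β) {F : Set Plane} (hF : IsClosed F) (hFS : F ⊆ gasket) :
    β F ≤ 3⁻¹ * ∑ i, β (simil i ⁻¹' F ∩ gasket) := by
  set G : Fin 3 → Set Plane := fun i => simil i ⁻¹' F ∩ gasket
  have hG (i) : IsClosed (G i) := (hF.preimage (continuous_simil i)).inter isClosed_gasket
  have hG_image (i) : IsClosed (simil i '' G i) := (similHomeomorph i).isClosedMap _ (hG i)
  have h_cover : F ⊆ simil 0 '' G 0 ∪ (simil 1 '' G 1 ∪ simil 2 '' G 2) := by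
    intro x hx
    obtain ⟨i, y, hy, rfl⟩ := exists_simil_eq (hFS hx)
    have h_mem : simil i y ∈ simil i '' G i := mem_image_of_mem _ ⟨hx, hy⟩
    fin_cases i
    exacts [Or.inl h_mem, Or.inr (Or.inl h_mem), Or.inr (Or.inr h_mem)]
  calc β F ≤ β (simil 0 '' G 0) + (β (simil 1 '' G 1) + β (simil 2 '' G 2)) := by
        refine (hβ.mono _ _ h_cover).trans
          ((hβ.union_le _ _ (hG_image 0) ((hG_image 1).union (hG_image 2))).trans ?_)
        gcongr
        exact hβ.union_le _ _ (hG_image 1) (hG_image 2)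
    _ ≤ 3⁻¹ * β (G 0) + (3⁻¹ * β (G 1) + 3⁻¹ * β (G 2)) := by
        gcongr <;> exact hβ.image_le _ _ (hG _) inter_subset_right
    _ = 3⁻¹ * ∑ i, β (G i) := by rw [Fin.sum_univ_three, mul_add, mul_add, add_assoc]

lemma cthickening_preimage_subset {i : Fin 3} {F : Set Plane} (hF : IsClosed F) {δ : ℝ}
    (hδ : 0 ≤ δ) :
    Metric.cthickening δ (simil i ⁻¹' F ∩ gasket) ⊆ simil i ⁻¹' Metric.cthickening (δ / 2) F := by
  intro y hy
  rw [(isCompact_gasket.inter_left (hF.preimage (continuous_simil i)))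
    |>.cthickening_eq_biUnion_closedBall hδ] at hy
  obtain ⟨z, hz, hyz⟩ := mem_iUnion₂.1 hy
  refine Metric.mem_cthickening_of_dist_le _ (simil i z) _ _ hz.1 ?_
  rw [dist_simil]
  exact div_le_div_of_nonneg_right hyz zero_le_two

lemma mul_le_mul_cthickening (hβ : IsScaling β) (hν : IsSelfSimilar ν) (k : ℕ) {F : Set Plane}
    (hF : IsClosed F) (hFS : F ⊆ gasket) :
    ν gasket * β F ≤ β gasket * ν (Metric.cthickening ((1 / 2) ^ k) F) := by
  induction k generalizing F with
  | zero =>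
    rcases F.eq_empty_or_nonempty with rfl | ⟨x, hx⟩
    · simp [hβ.empty]
    · rw [mul_comm]
      gcongr
      · exact hβ.mono _ _ hFS
      · refine fun y hy => Metric.mem_cthickening_of_dist_le y x _ _ hx ?_
        simpa using dist_le_one hy (hFS hx)
  | succ k ih =>
    have hG (i) : IsClosed (simil i ⁻¹' F ∩ gasket) :=
      (hF.preimage (continuous_simil i)).inter isClosed_gasket
    calc ν gasket * β F
        ≤ ν gasket * (3⁻¹ * ∑ i, β (simil i ⁻¹' F ∩ gasket)) := by
          gcongr; exact hβ.le_sum_preimage hF hFS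
      _ = 3⁻¹ * ∑ i, ν gasket * β (simil i ⁻¹' F ∩ gasket) := by
          rw [mul_left_comm, Finset.mul_sum]
      _ ≤ 3⁻¹ * ∑ i, β gasket * ν (simil i ⁻¹' Metric.cthickening ((1 / 2) ^ (k + 1)) F) := by
          gcongr 3⁻¹ * ∑ i, ?_ with i
          refine (ih (hG i) inter_subset_right).trans ?_
          rw [pow_succ, mul_one_div]
          gcongr
          exact cthickening_preimage_subset hF (by positivity)
      _ = β gasket * ν (Metric.cthickening ((1 / 2) ^ (k + 1)) F) := by
          rw [hν.measure_eq Metric.isClosed_cthickening.measurableSet, ← Finset.mul_sum,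
            mul_left_comm]

lemma mul_le_mul (hβ : IsScaling β) (hν : IsSelfSimilar ν) {F : Set Plane} (hF : IsClosed F)
    (hFS : F ⊆ gasket) : ν gasket * β F ≤ β gasket * ν F := by
  have h_tendsto : Tendsto (fun k : ℕ => ν (Metric.cthickening ((1 / 2 : ℝ) ^ k) F)) atTop
      (𝓝 (ν F)) :=
    (tendsto_measure_cthickening_of_isClosed ⟨1, one_pos, hν.measure_ne_top _⟩ hF).comp
      (tendsto_pow_atTop_nhds_zero_of_lt_one (by norm_num) (by norm_num))
  exact ge_of_tendsto' (ENNReal.Tendsto.const_mul h_tendsto (Or.inr hβ.ne_top))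
    fun k => hβ.mul_le_mul_cthickening hν k hF hFS

lemma mul_measure_closedBall_eq (hβ : IsScaling β) (hν : IsSelfSimilar ν) (x : Plane) {d : ℝ}
    (hd : 0 < d) : ν gasket * β (Metric.closedBall x d ∩ gasket)
      = β gasket * ν (Metric.closedBall x d) := by
  set B := Metric.closedBall x d ∩ gasket
  set E := gasket \ Metric.ball x d
  have hB : IsClosed B := Metric.isClosed_closedBall.inter isClosed_gasket
  have hE : IsClosed E := isClosed_gasket.sdiff Metric.isOpen_ball
  refine le_antisymm ?_ ?_
  · rw [← hν.measure_inter_gasket (Metric.closedBall x d)]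
    exact hβ.mul_le_mul hν hB inter_subset_right
  have hν_add : ν (Metric.closedBall x d) + ν E = ν gasket := by
    rw [← Metric.ball_union_sphere,
      measure_congr (union_ae_eq_left_of_ae_eq_empty (ae_eq_empty.2 (hν.measure_sphere x hd))),
      ← hν.measure_inter_gasket (Metric.ball x d), inter_comm]
    exact measure_inter_add_sdiff _ Metric.isOpen_ball.measurableSet
  have hβ_add : β gasket ≤ β B + β E := by
    refine (hβ.mono _ _ fun y hy => ?_).trans (hβ.union_le _ _ hB hE)
    by_cases h : y ∈ Metric.ball x d
    · exact Or.inl ⟨Metric.ball_subset_closedBall h, hy⟩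
    · exact Or.inr ⟨hy, h⟩
  have h_le : β gasket * ν (Metric.closedBall x d) + β gasket * ν E
      ≤ ν gasket * β B + β gasket * ν E := by
    calc β gasket * ν (Metric.closedBall x d) + β gasket * ν E
        = ν gasket * β gasket := by rw [← mul_add, hν_add, mul_comm]
      _ ≤ ν gasket * β B + ν gasket * β E := by rw [← mul_add]; gcongr
      _ ≤ ν gasket * β B + β gasket * ν E := by
        gcongr _ + ?_
        exact hβ.mul_le_mul hν hE sdiff_subset
  exact (ENNReal.add_le_add_iff_right (ENNReal.mul_ne_top hβ.ne_top (hν.measure_ne_top _))).1 h_le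

end IsScaling

namespace IsSelfSimilar

variable {ν : Measure Plane}

lemma measure_image_simil_le_of_measurableSet (hν : IsSelfSimilar ν) (i : Fin 3) {A : Set Plane}
    (hA : MeasurableSet A) (hAS : A ⊆ gasket) : ν (simil i '' A) ≤ 3⁻¹ * ν A := by
  have hA_image : MeasurableSet (simil i '' A) :=
    (similHomeomorph i).measurableEmbedding.measurableSet_image.2 hA
  rw [hν.measure_eq hA_image,
    Finset.sum_eq_single i (fun j _ hj => ?_) (by simp),
    preimage_image_eq _ (injective_simil i)]
  refine hν.measure_eq_zero_of_inter_subset (p := vertex i) ?_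
  rintro y ⟨⟨x, hx, hxy⟩, hy⟩
  exact eq_vertex_of_simil_eq_simil hj.symm (hAS hx) hy hxy

lemma measure_image_simil_le (hν : IsSelfSimilar ν) (i : Fin 3) {A : Set Plane}
    (hAS : A ⊆ gasket) : ν (simil i '' A) ≤ 3⁻¹ * ν A := by
  calc ν (simil i '' A) ≤ ν (simil i '' (toMeasurable ν A ∩ gasket)) :=
        measure_mono (image_mono (subset_inter (subset_toMeasurable ν A) hAS))
    _ ≤ 3⁻¹ * ν (toMeasurable ν A ∩ gasket) := hν.measure_image_simil_le_of_measurableSet i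
        ((measurableSet_toMeasurable ν A).inter isClosed_gasket.measurableSet) inter_subset_right
    _ = 3⁻¹ * ν A := by rw [hν.measure_inter_gasket, measure_toMeasurable]

lemma measure_eq_zero_of_invariant (hν : IsSelfSimilar ν) {D U : Set Plane} (hDS : D ⊆ gasket)
    (hD : ∀ i, ∀ x ∈ gasket, simil i x ∈ D → x ∈ D) (hU : IsOpen U) (hUS : (U ∩ gasket).Nonempty)
    (hDU : Disjoint D U) : ν D = 0 := by
  have hβ : IsScaling fun A => ν (A ∩ D) := by
    refine ⟨fun A B h => measure_mono (inter_subset_inter_left _ h), fun A B _ _ => ?_,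
      fun i A _ hA => ?_, hν.measure_ne_top _⟩
    · rw [union_inter_distrib_right]
      exact measure_union_le _ _
    · refine (measure_mono ?_).trans (hν.measure_image_simil_le i (inter_subset_right.trans hDS))
      rintro _ ⟨⟨x, hx, rfl⟩, hxD⟩
      exact ⟨x, ⟨hx, hD i x (hA hx) hxD⟩, rfl⟩
  obtain ⟨x, hxU, hx⟩ := hUS
  obtain ⟨d, hd, hB⟩ := Metric.nhds_basis_closedBall.mem_iff.1 (hU.mem_nhds hxU)
  have h_empty : Metric.closedBall x d ∩ gasket ∩ D = ∅ :=
    ((hDU.mono_right (inter_subset_left.trans hB)).symm).inter_eq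
  have h_eq := hβ.mul_measure_closedBall_eq hν x hd
  rw [h_empty, measure_empty, mul_zero, inter_eq_self_of_subset_right hDS] at h_eq
  exact (mul_eq_zero.1 h_eq.symm).resolve_right (hν.measure_closedBall_pos hx hd).ne'

end IsSelfSimilar

/-- The symmetry of the triangle that permutes the barycentric coordinates. -/
def permute (σ : Equiv.Perm (Fin 3)) (x : Plane) : Plane := ∑ j, bary (σ j) x • vertex j

lemma bary_sum_smul_vertex {c : Fin 3 → ℝ} (hc : ∑ j, c j = 1) (k : Fin 3) :
    bary k (∑ j, c j • vertex j) = c k := by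
  have h : Real.sqrt 3 ≠ 0 := by positivity
  rw [Fin.sum_univ_three] at hc ⊢
  fin_cases k <;> simp [bary, vertex] <;> field_simp <;> linarith

lemma bary_permute (σ : Equiv.Perm (Fin 3)) (k : Fin 3) (x : Plane) :
    bary k (permute σ x) = bary (σ k) x := by
  refine bary_sum_smul_vertex (c := fun j => bary (σ j) x) ?_ k
  rw [Equiv.sum_comp σ fun j => bary j x, Fin.sum_univ_three, sum_bary]

lemma dist_permute (σ : Equiv.Perm (Fin 3)) (x y : Plane) :
    dist (permute σ x) (permute σ y) = dist x y := by
  have h_sum := Equiv.sum_comp σ fun j => (bary j x - bary j y) ^ 2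
  rw [Fin.sum_univ_three, Fin.sum_univ_three] at h_sum
  rw [← sq_eq_sq₀ dist_nonneg dist_nonneg, dist_sq_eq, dist_sq_eq]
  simp only [bary_permute]
  rw [h_sum]

lemma permute_symm_permute (σ : Equiv.Perm (Fin 3)) (x : Plane) :
    permute σ.symm (permute σ x) = x :=
  ext_bary fun i => by simp [bary_permute]

lemma permute_simil (σ : Equiv.Perm (Fin 3)) (i : Fin 3) (x : Plane) :
    permute σ (simil i x) = simil (σ.symm i) (permute σ x) :=
  ext_bary fun k => by simp only [bary_permute, bary_simil, Equiv.symm_apply_eq]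

lemma permute_vertex (σ : Equiv.Perm (Fin 3)) (i : Fin 3) :
    permute σ (vertex i) = vertex (σ.symm i) :=
  ext_bary fun k => by simp only [bary_permute, bary_vertex, Equiv.symm_apply_eq]

lemma permute_mem_gasket (σ : Equiv.Perm (Fin 3)) {x : Plane} (hx : x ∈ gasket) :
    permute σ x ∈ gasket := by
  refine gasket_subset_of_mapsTo (K := permute σ ⁻¹' gasket)
    (isClosed_gasket.preimage (Isometry.of_dist_eq (dist_permute σ)).continuous)
    ⟨vertex 0, ?_⟩ (fun i y hy => ?_) hx
  · rw [mem_preimage, permute_vertex]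
    exact vertex_mem_gasket _
  · rw [mem_preimage, permute_simil]
    exact simil_mem_gasket _ hy

lemma preimage_permute_gasket (σ : Equiv.Perm (Fin 3)) : permute σ ⁻¹' gasket = gasket :=
  subset_antisymm (fun x hx => permute_symm_permute σ x ▸ permute_mem_gasket σ.symm hx)
    fun _ => permute_mem_gasket σ

lemma IsSelfSimilar.isScaling_preimage_permute {ν : Measure Plane} (hν : IsSelfSimilar ν)
    (σ : Equiv.Perm (Fin 3)) : IsScaling fun A => ν (permute σ ⁻¹' A) where
  mono _ _ h := measure_mono (preimage_mono h)
  union_le _ _ _ _ := measure_union_le _ _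
  image_le j A _ hA := by
    have hA' : permute σ ⁻¹' A ⊆ gasket := (preimage_mono hA).trans_eq (preimage_permute_gasket σ)
    refine (measure_mono ?_).trans (hν.measure_image_simil_le (σ j) hA')
    rintro x ⟨a, ha, hax⟩
    refine ⟨permute σ.symm a, ?_, ?_⟩
    · have h_inv := permute_symm_permute σ.symm a
      rw [Equiv.symm_symm] at h_inv
      rwa [mem_preimage, h_inv]
    · rw [← permute_symm_permute σ x, ← hax, permute_simil, Equiv.symm_symm]
  ne_top := hν.measure_ne_top _

lemma IsSelfSimilar.measure_closedBall_vertex {ν : Measure Plane} (hν : IsSelfSimilar ν)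
    (i : Fin 3) {d : ℝ} (hd : 0 < d) :
    ν (Metric.closedBall (vertex i) d) = ν (Metric.closedBall (vertex 0) d) := by
  set σ : Equiv.Perm (Fin 3) := Equiv.swap 0 i
  have h_vertex : permute σ (vertex i) = vertex 0 := by
    rw [permute_vertex, Equiv.symm_swap, Equiv.swap_apply_right]
  have h_ball : permute σ ⁻¹' Metric.closedBall (vertex 0) d = Metric.closedBall (vertex i) d := by
    ext x
    rw [mem_preimage, Metric.mem_closedBall, ← h_vertex, dist_permute, Metric.mem_closedBall]
  have h := (hν.isScaling_preimage_permute σ).mul_measure_closedBall_eq hν (vertex 0) hd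
  simp only [preimage_inter, preimage_permute_gasket, h_ball, hν.measure_inter_gasket] at h
  exact (ENNReal.mul_right_inj hν.measure_pos.ne' (hν.measure_ne_top _)).1 h

/-! ### Shift orbits and density spectra -/

lemma wordMap_succ' (i : ℕ → Fin 3) (k : ℕ) (x : Plane) :
    wordMap i (k + 1) x = simil (i 0) (wordMap (fun n => i (n + 1)) k x) := by
  induction k generalizing x with
  | zero => rfl
  | succ k ih => exact ih (simil (i (k + 1)) x)

lemma dist_wordMap (i : ℕ → Fin 3) (k : ℕ) (x y : Plane) :
    dist (wordMap i k x) (wordMap i k y) = (1 / 2) ^ k * dist x y := by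
  induction k generalizing x y with
  | zero => simp [wordMap]
  | succ k ih =>
    change dist (wordMap i k (simil (i k) x)) (wordMap i k (simil (i k) y)) = _
    rw [ih, dist_simil, pow_succ]
    ring

lemma IsCode.mem_gasket {i : ℕ → Fin 3} {x : Plane} (h : IsCode i x) : x ∈ gasket := by
  simpa [wordMap] using h 0

lemma IsCode.unique {i : ℕ → Fin 3} {x y : Plane} (hx : IsCode i x) (hy : IsCode i y) :
    x = y := by
  have h_dist (k : ℕ) : dist x y ≤ (1 / 2) ^ k := by
    obtain ⟨a, ha, rfl⟩ := hx k
    obtain ⟨b, hb, rfl⟩ := hy k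
    rw [dist_wordMap]
    exact mul_le_of_le_one_right (by positivity) (dist_le_one ha hb)
  exact dist_le_zero.1 <| ge_of_tendsto'
    (tendsto_pow_atTop_nhds_zero_of_lt_one (by norm_num) (by norm_num)) h_dist

lemma IsCode.of_tail {i : ℕ → Fin 3} {x : Plane} (h : IsCode (fun n => i (n + 1)) x) :
    IsCode i (simil (i 0) x)
  | 0 => ⟨_, simil_mem_gasket _ h.mem_gasket, rfl⟩
  | k + 1 => by
    obtain ⟨a, ha, rfl⟩ := h k
    exact ⟨a, ha, wordMap_succ' i k a⟩

lemma exists_isCode {x : Plane} (hx : x ∈ gasket) : ∃ i, IsCode i x := by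
  choose i y hy h_eq using fun x : gasket => exists_simil_eq x.2
  set g : gasket → gasket := fun x => ⟨y x, hy x⟩
  refine ⟨fun n => i (g^[n] ⟨x, hx⟩), fun k => ⟨g^[k] ⟨x, hx⟩, Subtype.coe_prop _, ?_⟩⟩
  induction k with
  | zero => rfl
  | succ k ih =>
    rw [Function.iterate_succ_apply']
    exact (congrArg (wordMap _ k) (h_eq _)).trans ih

lemma mem_geomShift_iff {A : Set Plane} {z : Plane} :
    z ∈ geomShift A ↔ z ∈ gasket ∧ ∃ i, simil i z ∈ A := by
  constructor
  · rintro ⟨x, hx, i, hi, hz⟩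
    exact ⟨hz.mem_gasket, i 0, hz.of_tail.unique hi ▸ hx⟩
  · rintro ⟨hz, j, hj⟩
    obtain ⟨i, hi⟩ := exists_isCode hz
    let c : ℕ → Fin 3 := fun n => Nat.casesOn n j i
    exact ⟨_, hj, c, IsCode.of_tail (i := c) hi, hi⟩

lemma geomShift_mono : Monotone geomShift := fun A B h z hz => by
  rw [mem_geomShift_iff] at hz ⊢
  exact ⟨hz.1, hz.2.imp fun i hi => h hi⟩

lemma iterate_geomShift_subset_gasket {y : Plane} (hy : y ∈ gasket) :
    ∀ k, geomShift^[k] {y} ⊆ gasket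
  | 0 => singleton_subset_iff.2 hy
  | k + 1 => fun z hz => by
    rw [Function.iterate_succ_apply', mem_geomShift_iff] at hz
    exact hz.1

lemma orbit_subset_orbit_simil {x : Plane} (hx : x ∈ gasket) (i : Fin 3) :
    (⋃ k : ℕ, geomShift^[k] {x}) ⊆ ⋃ k : ℕ, geomShift^[k] {simil i x} := by
  refine iUnion_subset fun k => subset_iUnion_of_subset (k + 1) ?_
  rw [Function.iterate_succ_apply]
  refine geomShift_mono.iterate k ?_
  rw [singleton_subset_iff, mem_geomShift_iff]
  exact ⟨hx, i, rfl⟩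

lemma mem_of_mem_iterate_geomShift {O : Set Plane} (hO : ∀ i, simil i '' O ⊆ O) {y z : Plane}
    {k : ℕ} (hz : z ∈ geomShift^[k] {y}) (hzO : z ∈ O) : y ∈ O := by
  induction k generalizing z with
  | zero => rwa [← mem_singleton_iff.1 hz]
  | succ k ih =>
    rw [Function.iterate_succ_apply', mem_geomShift_iff] at hz
    obtain ⟨_, i, hi⟩ := hz
    exact ih hi (hO i (mem_image_of_mem _ hzO))

lemma exists_mem_orbit_mem {y : Plane} (hy : y ∈ denseOrbitPoints) {U : Set Plane} (hU : IsOpen U)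
    (hUS : (U ∩ gasket).Nonempty) : ∃ k, ∃ z ∈ geomShift^[k] {y}, z ∈ U := by
  obtain ⟨x, hxU, hx⟩ := hUS
  obtain ⟨z, hzU, hz⟩ := mem_closure_iff.1 (hy.2 hx) U hU hxU
  obtain ⟨k, hk⟩ := mem_iUnion.1 hz
  exact ⟨k, z, hk, hzU⟩

lemma denseOrbitPoints_subset {O : Set Plane} (hO : IsFeasible O) :
    denseOrbitPoints ⊆ O ∩ gasket := by
  intro y hy
  obtain ⟨k, z, hz, hzO⟩ := exists_mem_orbit_mem hy hO.1 hO.2.2.2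
  exact ⟨mem_of_mem_iterate_geomShift hO.2.1 hz hzO, hy.1⟩

lemma densitySpectrum_eq_biUnion (α : Set Plane → ℝ≥0∞) (A : Set Plane) :
    densitySpectrum α A = ⋃ x ∈ A, densitySpectrum α {x} := by
  ext l
  simp [densitySpectrum]

lemma mem_densitySpectrum_singleton {α : Set Plane → ℝ≥0∞} {x : Plane} {l : ℝ≥0∞} :
    l ∈ densitySpectrum α {x} ↔ MapClusterPt l (𝓝[>] 0) (fun d : ℝ => density α x d) := by
  constructor
  · rintro ⟨_, rfl, d, hd_pos, hd, hl⟩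
    exact MapClusterPt.of_comp (tendsto_nhdsWithin_iff.2 ⟨hd, Eventually.of_forall hd_pos⟩)
      hl.mapClusterPt
  · intro h
    obtain ⟨d, hl, hd⟩ := h.exists_seq_tendsto
    obtain ⟨hd, hd_pos⟩ := tendsto_nhdsWithin_iff.1 hd
    obtain ⟨N, hN⟩ := eventually_atTop.1 hd_pos
    exact ⟨x, rfl, fun n => d (n + N), fun n => hN _ (Nat.le_add_left _ _),
      hd.comp (tendsto_add_atTop_nat N), hl.comp (tendsto_add_atTop_nat N)⟩

lemma frequently_nhdsGT_zero_iff {p : ℝ → Prop} :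
    (∃ᶠ d in 𝓝[>] (0 : ℝ), p d) ↔ ∀ ε > 0, ∃ d, 0 < d ∧ d < ε ∧ p d := by
  rw [(nhdsGT_basis (0 : ℝ)).frequently_iff]
  simp only [mem_Ioo, and_assoc]

lemma densitySpectrum_subset_of_eventually {α : Set Plane → ℝ≥0∞} {x : Plane} {V : Set ℝ≥0∞}
    (hV : IsClosed V) (h : ∀ᶠ d in 𝓝[>] (0 : ℝ), density α x d ∈ V) :
    densitySpectrum α {x} ⊆ V := by
  intro l hl
  rw [mem_densitySpectrum_singleton] at hl
  by_contra hlV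
  obtain ⟨d, hd, hd'⟩ := ((hl.frequently (hV.isOpen_compl.mem_nhds hlV)).and_eventually h).exists
  exact hd hd'

lemma IsTypical.eventually_nhdsWithin {x : Plane} {d : ℝ} (h : IsTypical x d) :
    ∀ᶠ z in 𝓝[gasket] x, IsTypical z d := by
  obtain ⟨-, hd, O, hO, hB⟩ := h
  obtain ⟨δ, hδ, hδO⟩ := (isCompact_closedBall x d).exists_cthickening_subset_open hO.1 hB
  rw [cthickening_closedBall hδ.le hd.le] at hδO
  filter_upwards [self_mem_nhdsWithin, mem_nhdsWithin_of_mem_nhds (Metric.closedBall_mem_nhds x hδ)]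
    with z hz hzx
  refine ⟨hz, hd, O, hO, (Metric.closedBall_subset_closedBall' ?_).trans hδO⟩
  linarith [Metric.mem_closedBall.1 hzx]

namespace IsSelfSimilar

variable {ν : Measure Plane}

lemma density_of_mem_iterate_geomShift (hν : IsSelfSimilar ν) {y z : Plane} {k : ℕ}
    (hz : z ∈ geomShift^[k] {y}) {d : ℝ} (h : IsTypical z d) :
    density ν y ((1 / 2) ^ k * d) = density ν z d := by
  induction k generalizing z d with
  | zero => rw [← mem_singleton_iff.1 hz, pow_zero, one_mul]
  | succ k ih =>
    rw [Function.iterate_succ_apply', mem_geomShift_iff] at hz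
    obtain ⟨_, i, hi⟩ := hz
    rw [pow_succ, mul_assoc, one_div_mul_eq_div 2 d, ih hi (h.map_simil i),
      hν.density_simil_of_isTypical h]

-- For each basic open set `U`, the points of the gasket whose orbit avoids `U` form an invariant
-- set, which is null since it does not meet `U` itself.
lemma measure_diff_denseOrbitPoints (hν : IsSelfSimilar ν) : ν (gasket \ denseOrbitPoints) = 0 := by
  set avoiding : Set Plane → Set Plane :=
    fun U => {x | x ∈ gasket ∧ Disjoint (⋃ k : ℕ, geomShift^[k] {x}) U}
  set B := TopologicalSpace.countableBasis Plane
  have hB := TopologicalSpace.isBasis_countableBasis Plane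
  have h_subset : gasket \ denseOrbitPoints
      ⊆ ⋃ U ∈ {U | U ∈ B ∧ (U ∩ gasket).Nonempty}, avoiding U := by
    rintro x ⟨hx, hx'⟩
    obtain ⟨p, hp, hp'⟩ := not_subset.1 fun h => hx' ⟨hx, h⟩
    rw [hB.mem_closure_iff] at hp'
    push Not at hp'
    obtain ⟨U, hU, hpU, h_disj⟩ := hp'
    exact mem_biUnion (⟨hU, p, hpU, hp⟩ : U ∈ {U | U ∈ B ∧ (U ∩ gasket).Nonempty})
      ⟨hx, (disjoint_iff_inter_eq_empty.2 h_disj).symm⟩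
  refine measure_mono_null h_subset ((measure_biUnion_null_iff
    ((TopologicalSpace.countable_countableBasis Plane).mono fun U hU => hU.1)).2 ?_)
  rintro U ⟨hUB, hUS⟩
  refine hν.measure_eq_zero_of_invariant (fun x hx => hx.1) ?_ (hB.isOpen hUB) hUS ?_
  · rintro i x hx ⟨_, h⟩
    exact ⟨hx, h.mono_left (orbit_subset_orbit_simil hx i)⟩
  · rw [Set.disjoint_left]
    rintro x ⟨_, h⟩ hxU
    exact Set.disjoint_left.1 h (mem_iUnion.2 ⟨0, rfl⟩) hxU

lemma denseOrbitPoints_nonempty (hν : IsSelfSimilar ν) : denseOrbitPoints.Nonempty := by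
  by_contra h_empty
  have h_null := hν.measure_diff_denseOrbitPoints
  rw [not_nonempty_iff_eq_empty.1 h_empty, sdiff_empty] at h_null
  exact hν.measure_pos.ne' h_null

lemma measure_inter_denseOrbitPoints (hν : IsSelfSimilar ν) (A : Set Plane) :
    ν (A ∩ denseOrbitPoints) = ν A := by
  refine measure_inter_conull (measure_mono_null (fun x hx => ?_)
    (measure_union_null hν.measure_diff_denseOrbitPoints hν.measure_compl))
  by_cases hxS : x ∈ gasket
  · exact Or.inl ⟨hxS, hx⟩
  · exact Or.inr hxS

lemma exists_density_mem_of_isTypical (hν : IsSelfSimilar ν) {y : Plane}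
    (hy : y ∈ denseOrbitPoints) {x : Plane} {d : ℝ} (h : IsTypical x d) {V : Set ℝ≥0∞}
    (hV : V ∈ 𝓝 (density ν x d)) : ∃ k : ℕ, density ν y ((1 / 2) ^ k * d) ∈ V := by
  have h_cont : ContinuousAt (fun z : Plane => density ν z d) x :=
    ContinuousAt.comp (f := fun z : Plane => (z, d)) (hν.continuousAt_density x h.2.1) (by fun_prop)
  have h_near : ∀ᶠ z in 𝓝[gasket] x, IsTypical z d ∧ density ν z d ∈ V :=
    h.eventually_nhdsWithin.and (h_cont.continuousWithinAt hV)
  obtain ⟨U, hU, hxU, hUV⟩ := mem_nhdsWithin.1 h_near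
  obtain ⟨k, z, hz, hzU⟩ := exists_mem_orbit_mem hy hU ⟨x, hxU, h.1⟩
  obtain ⟨hz_typical, hzV⟩ := hUV ⟨hzU, iterate_geomShift_subset_gasket hy.1 k hz⟩
  exact ⟨k, by rwa [hν.density_of_mem_iterate_geomShift hz hz_typical]⟩

lemma typicalDensities_subset_densitySpectrum (hν : IsSelfSimilar ν) {y : Plane}
    (hy : y ∈ denseOrbitPoints) : typicalDensities ν ⊆ densitySpectrum ν {y} := by
  rintro _ ⟨x, d, h, rfl⟩
  rw [mem_densitySpectrum_singleton, mapClusterPt_iff_frequently]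
  intro V hV
  rw [frequently_nhdsGT_zero_iff]
  intro ε hε
  obtain ⟨n, hn⟩ := exists_pow_lt_of_lt_one (div_pos hε h.2.1) (by norm_num : (1 / 2 : ℝ) < 1)
  rw [lt_div_iff₀ h.2.1] at hn
  have h_small := h.map_iterate_simil 0 n
  rw [← hν.density_iterate_simil_of_isTypical h 0 n] at hV
  obtain ⟨k, hk⟩ := hν.exists_density_mem_of_isTypical hy h_small hV
  have hd := h_small.2.1
  refine ⟨_, by positivity, (mul_le_of_le_one_left hd.le ?_).trans_lt hn, hk⟩
  exact pow_le_one₀ (by norm_num) (by norm_num)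

lemma densitySpectrum_subset_typicalDensities (hν : IsSelfSimilar ν) {O : Set Plane}
    (hO : IsFeasible O) {x : Plane} (hx : x ∈ O ∩ gasket) :
    densitySpectrum ν {x} ⊆ typicalDensities ν :=
  densitySpectrum_subset_of_eventually hν.isCompact_typicalDensities.isClosed
    ((hO.eventually_isTypical hx).mono fun d hd => ⟨x, d, hd, rfl⟩)

lemma densitySpectrum_eq_typicalDensities (hν : IsSelfSimilar ν) {O A : Set Plane}
    (hO : IsFeasible O) (hA : A ⊆ O ∩ gasket) (h : (A ∩ denseOrbitPoints).Nonempty) :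
    densitySpectrum ν A = typicalDensities ν := by
  obtain ⟨y, hyA, hy⟩ := h
  rw [densitySpectrum_eq_biUnion]
  exact subset_antisymm
    (iUnion₂_subset fun x hx => hν.densitySpectrum_subset_typicalDensities hO (hA hx))
    ((hν.typicalDensities_subset_densitySpectrum hy).trans
      (subset_biUnion_of_mem (u := fun x => densitySpectrum ν {x}) hyA))

lemma densitySpectrum_of_mem_denseOrbitPoints (hν : IsSelfSimilar ν) {y : Plane}
    (hy : y ∈ denseOrbitPoints) : densitySpectrum ν {y} = typicalDensities ν :=
  hν.densitySpectrum_eq_typicalDensities isFeasible_hexagon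
    (singleton_subset_iff.2 (denseOrbitPoints_subset isFeasible_hexagon hy)) ⟨y, rfl, hy⟩

lemma densitySpectrum_denseOrbitPoints (hν : IsSelfSimilar ν) :
    densitySpectrum ν denseOrbitPoints = typicalDensities ν :=
  hν.densitySpectrum_eq_typicalDensities isFeasible_hexagon
    (denseOrbitPoints_subset isFeasible_hexagon) (by simpa using hν.denseOrbitPoints_nonempty)

lemma densitySpectrum_feasible_inter_gasket (hν : IsSelfSimilar ν) {O : Set Plane}
    (hO : IsFeasible O) : densitySpectrum ν (O ∩ gasket) = typicalDensities ν := by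
  refine hν.densitySpectrum_eq_typicalDensities hO Subset.rfl ?_
  rw [inter_eq_right.2 (denseOrbitPoints_subset hO)]
  exact hν.denseOrbitPoints_nonempty

-- Around a point with dense orbit, both extreme densities are nearly attained at small radii, and
-- all the balls of intermediate radii are typical.
lemma ordConnected_typicalDensities (hν : IsSelfSimilar ν) : OrdConnected (typicalDensities ν) := by
  refine ordConnected_of_Ioo fun a ha b hb _ v hv => ?_
  obtain ⟨y, hy⟩ := hν.denseOrbitPoints_nonempty
  have h_spectrum := hν.typicalDensities_subset_densitySpectrum hy
  obtain ⟨ρ, hρ, h_typical⟩ := (nhdsGT_basis (0 : ℝ)).eventually_iff.1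
    (isFeasible_hexagon.eventually_isTypical (denseOrbitPoints_subset isFeasible_hexagon hy))
  obtain ⟨r₁, hr₁, hr₁ρ, hv₁⟩ := frequently_nhdsGT_zero_iff.1
    ((mem_densitySpectrum_singleton.1 (h_spectrum ha)).frequently (Iio_mem_nhds hv.1)) ρ hρ
  obtain ⟨r₂, hr₂, hr₂ρ, hv₂⟩ := frequently_nhdsGT_zero_iff.1
    ((mem_densitySpectrum_singleton.1 (h_spectrum hb)).frequently (Ioi_mem_nhds hv.2)) ρ hρ
  have h_subset : uIcc r₁ r₂ ⊆ Ioo 0 ρ :=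
    Icc_subset_Ioo (lt_min hr₁ hr₂) (max_lt hr₁ρ hr₂ρ)
  have h_cont : ContinuousOn (fun d : ℝ => density ν y d) (uIcc r₁ r₂) :=
    (hν.continuousOn_density y).mono fun d hd => (h_subset hd).1
  obtain ⟨r, hr, hrv⟩ := intermediate_value_uIcc h_cont
    (Icc_subset_uIcc ⟨le_of_lt hv₁, le_of_lt hv₂⟩)
  exact ⟨y, r, h_typical (h_subset hr), hrv.symm⟩

lemma typicalDensities_eq_Icc (hν : IsSelfSimilar ν) {a b : ℝ≥0∞}
    (ha : IsLeast (typicalDensities ν) a) (hb : IsGreatest (typicalDensities ν) b) :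
    typicalDensities ν = Icc a b :=
  subset_antisymm (fun _ hv => ⟨ha.2 hv, hb.2 hv⟩)
    (hν.ordConnected_typicalDensities.out ha.1 hb.1)

end IsSelfSimilar

/-! ### Densities at the vertices -/

/-- The densities at `z₀` of the balls with radii between `1/2` and `1`, a period of the density
under halving the radius. -/
def vertexDensities (α : Set Plane → ℝ≥0∞) : Set ℝ≥0∞ :=
  {l | ∃ d ∈ Icc (1 / 2 : ℝ) 1, l = density α (vertex 0) d}

lemma vertexDensities_eq_image (α : Set Plane → ℝ≥0∞) :
    vertexDensities α = (fun d : ℝ => density α (vertex 0) d) '' Icc (1 / 2) 1 := by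
  ext l
  simp only [vertexDensities, mem_ofPred_eq, mem_image, eq_comm]

lemma densitySpectrum_congr {α α' : Set Plane → ℝ≥0∞} {x y : Plane}
    (h : ∀ d > 0, density α x d = density α' y d) :
    densitySpectrum α {x} = densitySpectrum α' {y} := by
  have h_map : (𝓝[>] 0).map (fun d : ℝ => density α x d) = (𝓝[>] 0).map (density α' y) :=
    map_congr (eventually_mem_nhdsWithin.mono h)
  ext l
  rw [mem_densitySpectrum_singleton, mem_densitySpectrum_singleton, mapClusterPt_def,
    mapClusterPt_def, h_map]

-- The angle between `f_i(z_0) - z_0` and `y - z_0` is at most `60°`, so this is the law of cosines.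
lemma one_add_dist_add_dist_sq_le {i : Fin 3} (hi : i ≠ 0) {y : Plane} (hy : y ∈ gasket) :
    1 + dist y (vertex 0) + dist y (vertex 0) ^ 2 ≤ 4 * dist (simil i y) (vertex 0) ^ 2 := by
  have h₁ := bary_nonneg hy 1
  have h₂ := bary_nonneg hy 2
  have h_mul := mul_nonneg h₁ h₂
  have h₀ : bary 0 y = 1 - bary 1 y - bary 2 y := by linarith [sum_bary y]
  have h_sq := dist_sq_eq y (vertex 0)
  rw [dist_sq_eq (simil i y)]
  obtain rfl | rfl : i = 1 ∨ i = 2 := by omega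
  · simp only [bary_simil, bary_vertex, h₀, Fin.reduceEq, if_true, if_false] at h_sq ⊢
    have h_le : dist y (vertex 0) ≤ 2 * bary 1 y + bary 2 y :=
      (sq_le_sq₀ dist_nonneg (by positivity)).1 (by nlinarith)
    nlinarith
  · simp only [bary_simil, bary_vertex, h₀, Fin.reduceEq, if_true, if_false] at h_sq ⊢
    have h_le : dist y (vertex 0) ≤ 2 * bary 2 y + bary 1 y :=
      (sq_le_sq₀ dist_nonneg (by positivity)).1 (by nlinarith)
    nlinarith

lemma dist_vertex_zero_le {i : Fin 3} (hi : i ≠ 0) {y : Plane} (hy : y ∈ gasket)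
    (h : dist (simil i y) (vertex 0) ≤ 33 / 64) : dist y (vertex 0) ≤ (1 / 2) ^ 4 := by
  have h_sq : dist (simil i y) (vertex 0) ^ 2 ≤ (33 / 64) ^ 2 := pow_le_pow_left₀ dist_nonneg h 2
  nlinarith [one_add_dist_add_dist_sq_le hi hy, dist_nonneg (x := y) (y := vertex 0)]

lemma lt_diamPow : 1 + 3⁻¹ ^ 4 + 3⁻¹ ^ 4 < diamPow (33 / 64) := by
  have h_real : (1 + 3⁻¹ ^ 4 + 3⁻¹ ^ 4 : ℝ) < (2 * (33 / 64)) ^ dimS :=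
    lt_of_lt_of_le (by norm_num) (Real.self_le_rpow_of_one_le (by norm_num) one_le_dimS)
  have h := (ENNReal.ofReal_lt_ofReal_iff (by positivity)).2 h_real
  rwa [ENNReal.ofReal_add (by positivity) (by positivity),
    ENNReal.ofReal_add (by positivity) (by positivity), ENNReal.ofReal_pow (by positivity),
    ENNReal.ofReal_inv_of_pos three_pos, ENNReal.ofReal_ofNat, ENNReal.ofReal_one] at h

namespace IsSelfSimilar

variable {ν : Measure Plane}

lemma measure_closedBall_vertex_half (hν : IsSelfSimilar ν) {d : ℝ} (hd : d ≤ 1) :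
    ν (Metric.closedBall (vertex 0) (d / 2)) = 3⁻¹ * ν (Metric.closedBall (vertex 0) d) := by
  have h := hν.measure_closedBall_simil_of_le_one (l := 0) (x := vertex 0) (d := d)
    (by rwa [dist_self, zero_add])
  rwa [simil_vertex] at h

lemma density_vertex_pow_mul (hν : IsSelfSimilar ν) {d : ℝ} (hd : 0 < d) (hd₁ : d ≤ 1) (n : ℕ) :
    density ν (vertex 0) ((1 / 2) ^ n * d) = density ν (vertex 0) d := by
  induction n with
  | zero => rw [pow_zero, one_mul]
  | succ n ih =>
    have h_le : (1 / 2) ^ n * d ≤ 1 :=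
      (mul_le_of_le_one_left hd.le (pow_le_one₀ (by norm_num) (by norm_num))).trans hd₁
    rw [pow_succ, mul_right_comm, mul_one_div,
      density_half (by positivity) (hν.measure_closedBall_vertex_half h_le), ih]

lemma density_mem_vertexDensities (hν : IsSelfSimilar ν) {d : ℝ} (hd : 0 < d) (hd₁ : d ≤ 1) :
    density ν (vertex 0) d ∈ vertexDensities ν := by
  obtain ⟨n, r, hr, rfl⟩ := exists_pow_half_mul_mem_Icc hd hd₁
  exact ⟨r, hr, hν.density_vertex_pow_mul (by linarith [hr.1]) hr.2 n⟩

lemma eventually_density_mem_vertexDensities (hν : IsSelfSimilar ν) :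
    ∀ᶠ d in 𝓝[>] (0 : ℝ), density ν (vertex 0) d ∈ vertexDensities ν := by
  filter_upwards [Ioc_mem_nhdsGT (zero_lt_one' ℝ)] with d hd
  exact hν.density_mem_vertexDensities hd.1 hd.2

lemma frequently_density_vertex_eq (hν : IsSelfSimilar ν) {l : ℝ≥0∞}
    (hl : l ∈ vertexDensities ν) : ∃ᶠ d in 𝓝[>] (0 : ℝ), density ν (vertex 0) d = l := by
  obtain ⟨d, hd, rfl⟩ := hl
  have hd₀ : 0 < d := by linarith [hd.1]
  rw [frequently_nhdsGT_zero_iff]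
  intro ε hε
  obtain ⟨n, hn⟩ := exists_pow_lt_of_lt_one (div_pos hε hd₀) (by norm_num : (1 / 2 : ℝ) < 1)
  rw [lt_div_iff₀ hd₀] at hn
  exact ⟨_, by positivity, hn, hν.density_vertex_pow_mul hd₀ hd.2 n⟩

lemma continuousOn_density_vertex (hν : IsSelfSimilar ν) :
    ContinuousOn (fun d : ℝ => density ν (vertex 0) d) (Icc (1 / 2) 1) :=
  (hν.continuousOn_density _).mono fun _ hd => one_half_pos.trans_le hd.1

lemma isCompact_vertexDensities (hν : IsSelfSimilar ν) : IsCompact (vertexDensities ν) := by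
  rw [vertexDensities_eq_image]
  exact isCompact_Icc.image_of_continuousOn hν.continuousOn_density_vertex

lemma densitySpectrum_vertex (hν : IsSelfSimilar ν) (i : Fin 3) :
    densitySpectrum ν {vertex i} = vertexDensities ν := by
  have h_congr : densitySpectrum ν {vertex i} = densitySpectrum ν {vertex 0} :=
    densitySpectrum_congr fun d hd => by
      rw [density_eq_div_diamPow, density_eq_div_diamPow, hν.measure_closedBall_vertex i hd]
  rw [h_congr]
  refine subset_antisymm (densitySpectrum_subset_of_eventually
    hν.isCompact_vertexDensities.isClosed hν.eventually_density_mem_vertexDensities) fun l hl => ?_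
  rw [mem_densitySpectrum_singleton, mapClusterPt_iff_frequently]
  intro V hV
  exact (hν.frequently_density_vertex_eq hl).mono fun d hd => hd ▸ mem_of_mem_nhds hV

lemma isLeast_lowerDensity (hν : IsSelfSimilar ν) :
    IsLeast (vertexDensities ν) (lowerDensity ν (vertex 0)) := by
  obtain ⟨a, ha⟩ := hν.isCompact_vertexDensities.exists_isLeast ⟨_, 1, by norm_num, rfl⟩
  suffices h : lowerDensity ν (vertex 0) = a by rwa [h]
  exact le_antisymm
    (liminf_le_of_frequently_le ((hν.frequently_density_vertex_eq ha.1).mono fun d hd => hd.le))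
    (le_liminf_of_le (h := hν.eventually_density_mem_vertexDensities.mono fun d hd => ha.2 hd))

lemma isGreatest_upperDensity (hν : IsSelfSimilar ν) :
    IsGreatest (vertexDensities ν) (upperDensity ν (vertex 0)) := by
  obtain ⟨b, hb⟩ := hν.isCompact_vertexDensities.exists_isGreatest ⟨_, 1, by norm_num, rfl⟩
  suffices h : upperDensity ν (vertex 0) = b by rwa [h]
  exact le_antisymm
    (limsup_le_of_le (h := hν.eventually_density_mem_vertexDensities.mono fun d hd => hb.2 hd))
    (le_limsup_of_frequently_le
      ((hν.frequently_density_vertex_eq hb.1).mono fun d hd => hd.ge))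

lemma vertexDensities_eq_Icc (hν : IsSelfSimilar ν) :
    vertexDensities ν = Icc (lowerDensity ν (vertex 0)) (upperDensity ν (vertex 0)) := by
  refine subset_antisymm
    (fun l hl => ⟨hν.isLeast_lowerDensity.2 hl, hν.isGreatest_upperDensity.2 hl⟩) ?_
  have h_conn : IsPreconnected (vertexDensities ν) := by
    rw [vertexDensities_eq_image]
    exact isPreconnected_Icc.image _ hν.continuousOn_density_vertex
  exact h_conn.Icc_subset hν.isLeast_lowerDensity.1 hν.isGreatest_upperDensity.1

lemma densitySpectrum_gasket (hν : IsSelfSimilar ν) :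
    densitySpectrum ν gasket = vertexDensities ν ∪ typicalDensities ν := by
  rw [densitySpectrum_eq_biUnion]
  refine subset_antisymm (iUnion₂_subset fun x hx => ?_) (union_subset ?_ ?_)
  · by_cases h : ∃ i, x = vertex i
    · obtain ⟨i, rfl⟩ := h
      exact (hν.densitySpectrum_vertex i).trans_subset subset_union_left
    · push Not at h
      exact (hν.densitySpectrum_subset_typicalDensities isFeasible_hexagon
        ⟨mem_hexagon_of_mem_gasket hx h, hx⟩).trans subset_union_right
  · rw [← hν.densitySpectrum_vertex 0]
    exact subset_biUnion_of_mem (u := fun x => densitySpectrum ν {x}) (vertex_mem_gasket 0)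
  · obtain ⟨y, hy⟩ := hν.denseOrbitPoints_nonempty
    rw [← hν.densitySpectrum_of_mem_denseOrbitPoints hy]
    exact subset_biUnion_of_mem (u := fun x => densitySpectrum ν {x}) hy.1

lemma measure_closedBall_vertex_pow (hν : IsSelfSimilar ν) (n : ℕ) :
    ν (Metric.closedBall (vertex 0) ((1 / 2) ^ n)) = 3⁻¹ ^ n * ν gasket := by
  induction n with
  | zero =>
    rw [pow_zero, pow_zero, one_mul]
    exact le_antisymm (hν.le_measure_gasket _)
      (measure_mono fun y hy => dist_le_one hy (vertex_mem_gasket 0))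
  | succ n ih =>
    rw [pow_succ, mul_one_div, hν.measure_closedBall_vertex_half
      (pow_le_one₀ (by norm_num) (by norm_num)), ih, pow_succ', mul_assoc]

lemma density_vertex_half (hν : IsSelfSimilar ν) :
    density ν (vertex 0) (1 / 2) = 3⁻¹ * ν gasket := by
  have h := hν.measure_closedBall_vertex_pow 1
  rw [pow_one, pow_one] at h
  rw [density_eq_div_diamPow, h]
  simp [diamPow]

lemma measure_closedBall_vertex_le (hν : IsSelfSimilar ν) :
    ν (Metric.closedBall (vertex 0) (33 / 64))
      ≤ 3⁻¹ * ν gasket * (1 + 3⁻¹ ^ 4 + 3⁻¹ ^ 4) := by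
  have h_other {i : Fin 3} (hi : i ≠ 0) :
      ν (simil i ⁻¹' Metric.closedBall (vertex 0) (33 / 64)) ≤ 3⁻¹ ^ 4 * ν gasket := by
    rw [← hν.measure_closedBall_vertex_pow, ← hν.measure_inter_gasket]
    exact measure_mono fun y hy => dist_vertex_zero_le hi hy.2 hy.1
  calc ν (Metric.closedBall (vertex 0) (33 / 64))
      = 3⁻¹ * ∑ i, ν (simil i ⁻¹' Metric.closedBall (vertex 0) (33 / 64)) :=
        hν.measure_eq Metric.isClosed_closedBall.measurableSet
    _ ≤ 3⁻¹ * (ν gasket + 3⁻¹ ^ 4 * ν gasket + 3⁻¹ ^ 4 * ν gasket) := by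
        rw [Fin.sum_univ_three]
        gcongr 3⁻¹ * (?_ + ?_ + ?_)
        · exact hν.le_measure_gasket _
        · exact h_other (by decide)
        · exact h_other (by decide)
    _ = 3⁻¹ * ν gasket * (1 + 3⁻¹ ^ 4 + 3⁻¹ ^ 4) := by ring

lemma density_vertex_lt (hν : IsSelfSimilar ν) :
    density ν (vertex 0) (33 / 64) < density ν (vertex 0) (1 / 2) := by
  rw [hν.density_vertex_half]
  refine ENNReal.div_lt_of_lt_mul (hν.measure_closedBall_vertex_le.trans_lt ?_)
  exact ENNReal.mul_lt_mul_right (mul_ne_zero (by simp) hν.measure_pos.ne')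
    (ENNReal.mul_ne_top (by simp) (hν.measure_ne_top _)) lt_diamPow

lemma lowerDensity_lt_upperDensity (hν : IsSelfSimilar ν) :
    lowerDensity ν (vertex 0) < upperDensity ν (vertex 0) :=
  (hν.isLeast_lowerDensity.2 ⟨33 / 64, by norm_num, rfl⟩).trans_lt
    (hν.density_vertex_lt.trans_le (hν.isGreatest_upperDensity.2 ⟨1 / 2, by norm_num, rfl⟩))

lemma density_midpoint (hν : IsSelfSimilar ν) {d : ℝ} (hd : 0 < d) (hd' : d ≤ 4 / 5) :
    density ν (simil 0 (vertex 1)) (d / 2) = 2 * density ν (vertex 0) d := by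
  have h := hν.measure_closedBall_junction (j := 0) (l := 1) (by decide) (x := vertex 1)
    (x' := vertex 0) (r := d) (by simp only [simil]; module) (by rw [dist_self]; linarith)
  rw [hν.measure_closedBall_vertex 1 hd] at h
  rw [density_eq_div_diamPow, density_eq_div_diamPow, h, diamPow_half hd.le,
    ENNReal.mul_div_mul_left _ _ (by simp) (by simp), ← two_mul, mul_div_assoc]

lemma two_mul_density_vertex_mem_typicalDensities (hν : IsSelfSimilar ν) {d : ℝ} (hd : 0 < d)
    (hd₁ : d ≤ 1) : 2 * density ν (vertex 0) d ∈ typicalDensities ν := by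
  have h_pos : 0 < (1 / 2 : ℝ) ^ 3 * d := by positivity
  have h_le : (1 / 2 : ℝ) ^ 3 * d ≤ 1 / 8 := by norm_num; linarith
  rw [← hν.density_vertex_pow_mul hd hd₁ 3, ← hν.density_midpoint h_pos (h_le.trans (by norm_num))]
  have h_typical := isTypical_simil_simil (vertex_mem_gasket 1) (j := 0) (l := 1) (by decide)
    (half_pos h_pos) (by linarith)
  rw [simil_vertex] at h_typical
  exact ⟨_, _, h_typical, rfl⟩

lemma lt_of_isLeast_of_isGreatest (hν : IsSelfSimilar ν) {a b : ℝ≥0∞}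
    (ha : IsLeast (typicalDensities ν) a) (hb : IsGreatest (typicalDensities ν) b) : a < b :=
  calc a ≤ 2 * density ν (vertex 0) (33 / 64) :=
        ha.2 (hν.two_mul_density_vertex_mem_typicalDensities (by norm_num) (by norm_num))
    _ < 2 * density ν (vertex 0) (1 / 2) :=
        ENNReal.mul_lt_mul_right two_ne_zero (by simp) hν.density_vertex_lt
    _ ≤ b := hb.2 (hν.two_mul_density_vertex_mem_typicalDensities (by norm_num) (by norm_num))

end IsSelfSimilar

/-! ### Scaling of the metric measures -/

lemma diamSum_dimS (t : Set (Plane × ℝ)) :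
    diamSum dimS t = ∑' p : t, diamPow (p : Plane × ℝ).2 := rfl

lemma diamSum_union_le (t u : Set (Plane × ℝ)) :
    diamSum dimS (t ∪ u) ≤ diamSum dimS t + diamSum dimS u :=
  ENNReal.tsum_union_le (fun p : Plane × ℝ => diamPow p.2) t u

/-- The action of the similitude `f_i` on balls, encoded by centre and radius. -/
def ballMap (i : Fin 3) (p : Plane × ℝ) : Plane × ℝ := (simil i p.1, p.2 / 2)

lemma injective_ballMap (i : Fin 3) : Function.Injective (ballMap i) :=
  (injective_simil i).prodMap fun _ _ h => (div_left_inj' two_ne_zero).1 h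

lemma surjective_ballMap (i : Fin 3) : Function.Surjective (ballMap i) :=
  (surjective_simil i).prodMap (g := (· / 2)) fun d => ⟨d * 2, mul_div_cancel_right₀ d two_ne_zero⟩

lemma closedBall_ballMap (i : Fin 3) (p : Plane × ℝ) :
    Metric.closedBall (ballMap i p).1 (ballMap i p).2 = simil i '' Metric.closedBall p.1 p.2 :=
  (image_simil_closedBall i p.1 p.2).symm

lemma diamSum_image_ballMap {t : Set (Plane × ℝ)} (ht : ∀ p ∈ t, 0 < p.2) (i : Fin 3) :
    diamSum dimS (ballMap i '' t) = 3⁻¹ * diamSum dimS t := by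
  rw [diamSum_dimS, diamSum_dimS, tsum_image (fun p : Plane × ℝ => diamPow p.2)
    (injective_ballMap i).injOn, ← ENNReal.tsum_mul_left]
  exact tsum_congr fun p => diamPow_half (ht p p.2).le

lemma IsFineFamily.union {δ : ℝ} {t u : Set (Plane × ℝ)} (ht : IsFineFamily δ t)
    (hu : IsFineFamily δ u) : IsFineFamily δ (t ∪ u) :=
  ⟨ht.1.union hu.1, fun p hp => hp.elim (ht.2 p) (hu.2 p)⟩

lemma isFineFamily_image_ballMap {δ : ℝ} {t : Set (Plane × ℝ)} {i : Fin 3} :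
    IsFineFamily (δ / 2) (ballMap i '' t) ↔ IsFineFamily δ t := by
  refine and_congr ⟨countable_of_injective_of_countable_image (injective_ballMap i).injOn,
    fun ht => ht.image _⟩ (forall_mem_image.trans (forall₂_congr fun p _ => ?_))
  simp only [ballMap]
  rw [← mul_div_assoc, div_le_div_iff_of_pos_right two_pos, div_pos_iff_of_pos_right two_pos]

lemma IsFineFamily.mono {δ δ' : ℝ} {t : Set (Plane × ℝ)} (ht : IsFineFamily δ t) (h : δ ≤ δ') :
    IsFineFamily δ' t :=
  ⟨ht.1, fun p hp => ⟨(ht.2 p hp).1, (ht.2 p hp).2.trans h⟩⟩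

lemma Covers.union {t u : Set (Plane × ℝ)} {A B : Set Plane} (ht : Covers t A)
    (hu : Covers u B) : Covers (t ∪ u) (A ∪ B) := by
  rw [Covers, biUnion_union]
  exact union_subset_union ht hu

lemma Covers.image {t : Set (Plane × ℝ)} {A : Set Plane} (h : Covers t A) (i : Fin 3) :
    Covers (ballMap i '' t) (simil i '' A) := by
  rw [Covers, biUnion_image]
  simp only [closedBall_ballMap]
  rw [← image_iUnion₂]
  exact image_mono h

lemma Covers.measure_le {t : Set (Plane × ℝ)} {A : Set Plane} (h : Covers t A)
    (ht : t.Countable) (ν : Measure Plane) :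
    ν A ≤ ∑' p : t, ν (Metric.closedBall (p : Plane × ℝ).1 (p : Plane × ℝ).2) :=
  (measure_mono h).trans (measure_biUnion_le ν ht _)

/-- The least sum `∑ (2d)^s` over the coverings of `A` by balls of diameter at most `δ` centred
in `Q`. -/
def coveringSum (δ : ℝ) (Q A : Set Plane) : ℝ≥0∞ :=
  ⨅ (t : Set (Plane × ℝ)) (_ : IsFineFamily δ t ∧ (∀ p ∈ t, p.1 ∈ Q) ∧ Covers t A), diamSum dimS t

/-- The premeasure defined by coverings by balls centred in `Q`. The spherical Hausdorff measure and
the premeasure `C₀ˢ` are the cases in which `Q` is the plane and the covered set. -/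
def coveringPre (Q A : Set Plane) : ℝ≥0∞ := ⨆ (δ : ℝ) (_ : 0 < δ), coveringSum δ Q A

lemma sphericalHausdorff_eq (A : Set Plane) :
    sphericalHausdorff dimS A = coveringPre univ A := by
  simp only [sphericalHausdorff, coveringPre, coveringSum, mem_univ, implies_true, true_and]

lemma centredPre_eq (A : Set Plane) : centredPre dimS A = coveringPre A A := rfl

lemma coveringSum_le_coveringPre {δ : ℝ} (hδ : 0 < δ) (Q A : Set Plane) :
    coveringSum δ Q A ≤ coveringPre Q A :=
  le_iSup₂ (f := fun (δ : ℝ) (_ : 0 < δ) => coveringSum δ Q A) δ hδ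

lemma coveringPre_mono {Q Q' A A' : Set Plane} (hQ : Q' ⊆ Q) (hA : A ⊆ A') :
    coveringPre Q A ≤ coveringPre Q' A' :=
  iSup₂_mono fun _ _ => le_iInf₂ fun t ht => iInf₂_le t
    ⟨ht.1, fun p hp => hQ (ht.2.1 p hp), hA.trans ht.2.2⟩

lemma coveringPre_union_le (Q Q' A A' : Set Plane) :
    coveringPre (Q ∪ Q') (A ∪ A') ≤ coveringPre Q A + coveringPre Q' A' := by
  refine iSup₂_le fun δ hδ => le_trans ?_ (add_le_add (coveringSum_le_coveringPre hδ Q A)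
    (coveringSum_le_coveringPre hδ Q' A'))
  refine ENNReal.le_iInf₂_add_iInf₂ fun t ht u hu => ?_
  exact (iInf₂_le (t ∪ u) ⟨ht.1.union hu.1, fun p hp => hp.imp (ht.2.1 p) (hu.2.1 p),
    ht.2.2.union hu.2.2⟩).trans (diamSum_union_le t u)

lemma coveringPre_image_le (i : Fin 3) (Q A : Set Plane) :
    coveringPre (simil i '' Q) (simil i '' A) ≤ 3⁻¹ * coveringPre Q A := by
  refine iSup₂_le fun δ hδ => le_trans ?_
    (mul_le_mul_right (coveringSum_le_coveringPre hδ Q A) _)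
  simp only [coveringSum, ENNReal.mul_iInf_of_ne (a := 3⁻¹) (by simp) (by simp)]
  refine le_iInf₂ fun t ht => ?_
  rw [← diamSum_image_ballMap (fun p hp => (ht.1.2 p hp).1) i]
  exact iInf₂_le _ ⟨(isFineFamily_image_ballMap.2 ht.1).mono (by linarith),
    forall_mem_image.2 fun p hp => mem_image_of_mem _ (ht.2.1 p hp), ht.2.2.image i⟩

lemma measure_le_mul_coveringPre {ν : Measure Plane} {Q A : Set Plane} {κ : ℝ≥0∞} (hκ : κ ≠ 0)
    (hκ' : κ ≠ ⊤) {ρ : ℝ} (hρ : 0 < ρ)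
    (h : ∀ x ∈ Q, ∀ d, 0 < d → d ≤ ρ → ν (Metric.closedBall x d) ≤ κ * diamPow d) :
    ν A ≤ κ * coveringPre Q A := by
  refine le_trans ?_ (mul_le_mul_right (coveringSum_le_coveringPre hρ Q A) κ)
  simp only [coveringSum, ENNReal.mul_iInf_of_ne hκ hκ']
  refine le_iInf₂ fun t ht => (ht.2.2.measure_le ht.1.1 ν).trans ?_
  rw [diamSum_dimS, ← ENNReal.tsum_mul_left]
  refine ENNReal.tsum_le_tsum fun p => ?_
  obtain ⟨h_pos, h_le⟩ := ht.1.2 p p.2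
  exact h _ (ht.2.1 p p.2) _ h_pos (by linarith)

lemma isScaling_sphericalHausdorff (h : sphericalHausdorff dimS gasket ≠ ⊤) :
    IsScaling (sphericalHausdorff dimS) := by
  refine ⟨fun A B hAB => ?_, fun A B _ _ => ?_, fun i A _ _ => ?_, h⟩ <;>
    simp only [sphericalHausdorff_eq]
  · exact coveringPre_mono subset_rfl hAB
  · simpa only [union_self] using coveringPre_union_le univ univ A B
  · simpa only [image_univ, (surjective_simil i).range_eq] using coveringPre_image_le i univ A

lemma centredPre_le_centredHausdorff {F A : Set Plane} (hF : IsClosed F) (hFA : F ⊆ A) :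
    centredPre dimS F ≤ centredHausdorff dimS A :=
  le_iSup₂ (f := fun (F : Set Plane) (_ : F ⊆ A ∧ IsClosed F) => centredPre dimS F) F ⟨hFA, hF⟩

lemma isScaling_centredHausdorff (h : centredHausdorff dimS gasket ≠ ⊤) :
    IsScaling (centredHausdorff dimS) where
  mono A B hAB := iSup₂_le fun F hF => centredPre_le_centredHausdorff hF.2 (hF.1.trans hAB)
  union_le A B hA hB := iSup₂_le fun F hF => by
    rw [centredPre_eq, ← inter_eq_self_of_subset_left hF.1, inter_union_distrib_left]
    exact (coveringPre_union_le _ _ _ _).trans (add_le_add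
      (centredPre_le_centredHausdorff (hF.2.inter hA) inter_subset_right)
      (centredPre_le_centredHausdorff (hF.2.inter hB) inter_subset_right))
  image_le i A _ _ := iSup₂_le fun F hF => by
    rw [centredPre_eq, ← image_preimage_eq F (surjective_simil i)]
    refine (coveringPre_image_le i _ _).trans ?_
    gcongr
    exact centredPre_le_centredHausdorff (hF.2.preimage (continuous_simil i))
      ((preimage_mono hF.1).trans (preimage_image_eq A (injective_simil i)).subset)
  ne_top := h

lemma packingPre_empty : packingPre dimS ∅ = 0 := by
  refine le_antisymm (iInf₂_le_of_le 1 one_pos (iSup₂_le fun t ht => ?_)) zero_le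
  obtain rfl : t = ∅ := eq_empty_iff_forall_notMem.2 fun p hp => ht.2.1 p hp
  rw [diamSum_dimS, tsum_empty]

lemma packingPre_mono {A B : Set Plane} (h : A ⊆ B) : packingPre dimS A ≤ packingPre dimS B :=
  iInf₂_mono fun _ _ => iSup₂_le fun t ht =>
    le_iSup₂_of_le t ⟨ht.1, fun p hp => h (ht.2.1 p hp), ht.2.2⟩ le_rfl

lemma packingPre_image_le (i : Fin 3) (F : Set Plane) :
    packingPre dimS (simil i '' F) ≤ 3⁻¹ * packingPre dimS F := by
  conv_rhs => rw [packingPre]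
  simp only [ENNReal.mul_iInf_of_ne (a := 3⁻¹) (by simp) (by simp)]
  refine le_iInf₂ fun δ hδ => iInf₂_le_of_le (δ / 2) (half_pos hδ) (iSup₂_le fun u hu => ?_)
  obtain ⟨t, rfl⟩ : ∃ t, ballMap i '' t = u := (surjective_ballMap i).image_surjective u
  have ht := isFineFamily_image_ballMap.1 hu.1
  rw [diamSum_image_ballMap (fun p hp => (ht.2 p hp).1) i]
  gcongr
  refine le_iSup₂_of_le t ⟨ht, fun p hp => ?_, ?_⟩ le_rfl
  · exact (injective_simil i).mem_set_image.1 (hu.2.1 _ (mem_image_of_mem _ hp))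
  · have h_disjoint := (injective_ballMap i).injOn.pairwiseDisjoint_image.1 hu.2.2
    refine h_disjoint.imp fun p q h => ?_
    rw [Function.onFun, Function.comp_apply, Function.comp_apply, closedBall_ballMap,
      closedBall_ballMap, disjoint_image_iff (injective_simil i)] at h
    exact h

lemma packing_eq_inducedOuterMeasure (A : Set Plane) :
    packing dimS A = inducedOuterMeasure (fun F (_ : IsClosed F) => packingPre dimS F)
      isClosed_empty packingPre_empty A := by
  rw [inducedOuterMeasure, OuterMeasure.ofFunction_apply]
  refine le_antisymm (le_iInf₂ fun F hF => ?_) (le_iInf₂ fun F hF => iInf₂_le_of_le F hF.2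
    (ENNReal.tsum_le_tsum fun n => (extend_eq _ (hF.1 n)).le))
  by_cases h_closed : ∀ n, IsClosed (F n)
  · exact iInf₂_le_of_le F ⟨h_closed, hF⟩ (ENNReal.tsum_le_tsum fun n => le_extend _ (h_closed n))
  · obtain ⟨n, hn⟩ := not_forall.1 h_closed
    exact le_top.trans (ENNReal.tsum_eq_top_of_eq_top ⟨n, extend_eq_top _ hn⟩).ge

lemma packing_le_packingPre {A : Set Plane} (hA : IsClosed A) :
    packing dimS A ≤ packingPre dimS A := by
  rw [packing_eq_inducedOuterMeasure]
  exact (OuterMeasure.ofFunction_le A).trans (extend_eq _ hA).le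

lemma packing_image_le (i : Fin 3) (A : Set Plane) :
    packing dimS (simil i '' A) ≤ 3⁻¹ * packing dimS A := by
  conv_rhs => rw [packing]
  simp only [ENNReal.mul_iInf_of_ne (a := 3⁻¹) (by simp) (by simp), ← ENNReal.tsum_mul_left]
  refine le_iInf₂ fun F hF => iInf₂_le_of_le (fun n => simil i '' F n)
    ⟨fun n => (similHomeomorph i).isClosedMap _ (hF.1 n), ?_⟩
    (ENNReal.tsum_le_tsum fun n => packingPre_image_le i (F n))
  rw [← image_iUnion]
  exact image_mono hF.2

lemma isScaling_packing (h : packing dimS gasket ≠ ⊤) : IsScaling (packing dimS) where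
  mono A B hAB := by
    simp only [packing_eq_inducedOuterMeasure]
    exact measure_mono hAB
  union_le A B _ _ := by
    simp only [packing_eq_inducedOuterMeasure]
    exact measure_union_le A B
  image_le i A _ _ := packing_image_le i A
  ne_top := h

lemma isScaling_hausdorffMeasure (h : μH[dimS] gasket ≠ ⊤) :
    IsScaling fun A : Set Plane => μH[dimS] A where
  mono _ _ := measure_mono
  union_le A B _ _ := measure_union_le A B
  image_le i A _ _ := by
    refine ((contractingWith_simil i).2.hausdorffMeasure_image_le dimS_pos.le A).trans_eq ?_
    rw [← ofReal_half_rpow_dimS, ← ENNReal.ofReal_rpow_of_pos one_half_pos,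
      ← NNReal.coe_two, ← NNReal.coe_one, ← NNReal.coe_div, ENNReal.ofReal_coe_nnreal]
  ne_top := h

lemma ediam_closedBall_rpow_le (x : Plane) {d : ℝ} (hd : 0 < d) :
    Metric.ediam (Metric.closedBall x d) ^ dimS ≤ diamPow d := by
  rw [diamPow, ← ENNReal.ofReal_rpow_of_pos (by positivity), ENNReal.ofReal_mul zero_le_two,
    ENNReal.ofReal_ofNat, ← Metric.closedEBall_ofReal hd.le]
  exact ENNReal.rpow_le_rpow Metric.ediam_closedEBall_le dimS_pos.le

lemma hausdorffMeasure_le_sphericalHausdorff (A : Set Plane) :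
    μH[dimS] A ≤ sphericalHausdorff dimS A := by
  refine le_of_forall_gt_imp_ge_of_dense fun c hc => ?_
  have h_cover (n : ℕ) : ∃ t, IsFineFamily (1 / (n + 1)) t ∧ Covers t A ∧ diamSum dimS t < c := by
    have h_lt : coveringSum (1 / (n + 1)) univ A < c :=
      (coveringSum_le_coveringPre Nat.one_div_pos_of_nat univ A).trans_lt
        (sphericalHausdorff_eq A ▸ hc)
    simp only [coveringSum, iInf_lt_iff, exists_prop] at h_lt
    obtain ⟨t, ht, h⟩ := h_lt
    exact ⟨t, ht.1, ht.2.2, h⟩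
  choose t ht ht_cover ht_lt using h_cover
  have (n : ℕ) : Countable (t n) := (ht n).1.to_subtype
  have h_tendsto : Tendsto (fun n : ℕ => ENNReal.ofReal (1 / ((n : ℝ) + 1))) atTop (𝓝 0) := by
    simpa only [ENNReal.ofReal_zero] using
      ENNReal.tendsto_ofReal tendsto_one_div_add_atTop_nhds_zero_nat
  refine (Measure.hausdorffMeasure_le_liminf_tsum dimS A _ h_tendsto
    (fun n (p : t n) => Metric.closedBall (p : Plane × ℝ).1 (p : Plane × ℝ).2)
    (.of_forall fun n p => ?_) (.of_forall fun n => ?_)).trans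
    (liminf_le_of_frequently_le (.of_forall fun n => le_trans ?_ (ht_lt n).le))
  · obtain ⟨h_pos, h_le⟩ := (ht n).2 p p.2
    rw [← Metric.closedEBall_ofReal h_pos.le]
    refine Metric.ediam_closedEBall_le.trans ?_
    rw [← ENNReal.ofReal_ofNat 2, ← ENNReal.ofReal_mul zero_le_two]
    exact ENNReal.ofReal_le_ofReal h_le
  · rw [iUnion_subtype]
    exact ht_cover n
  · exact ENNReal.tsum_le_tsum fun p => ediam_closedBall_rpow_le _ ((ht n).2 p p.2).1

/-! ### Density theorems for coverings and packings -/

section Density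

variable {ν : Measure Plane} {κ : ℝ≥0∞}

lemma le_density_iff {α : Set Plane → ℝ≥0∞} {x : Plane} {d : ℝ} (hd : 0 < d) :
    κ ≤ density α x d ↔ κ * diamPow d ≤ α (Metric.closedBall x d) := by
  rw [density_eq_div_diamPow, ENNReal.le_div_iff_mul_le (Or.inl (diamPow_ne_zero hd))
    (Or.inl (diamPow_ne_top d))]

lemma density_le_iff {α : Set Plane → ℝ≥0∞} {x : Plane} {d : ℝ} (hd : 0 < d) :
    density α x d ≤ κ ↔ α (Metric.closedBall x d) ≤ κ * diamPow d := by
  rw [density_eq_div_diamPow, ENNReal.div_le_iff (diamPow_ne_zero hd) (diamPow_ne_top d)]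

lemma isFineFamily_graphOn {δ : ℝ} {r : Plane → ℝ} {T : Set Plane} (hT : T.Countable)
    (hr : ∀ x ∈ T, 0 < r x ∧ r x < δ / 2) : IsFineFamily δ (T.graphOn r) :=
  ⟨hT.image _, forall_mem_image.2 fun x hx => ⟨(hr x hx).1, by linarith [(hr x hx).2]⟩⟩

lemma diamSum_graphOn (r : Plane → ℝ) (T : Set Plane) :
    diamSum dimS (T.graphOn r) = ∑' x : T, diamPow (r x) :=
  tsum_image (fun p : Plane × ℝ => diamPow p.2) fun _ _ _ _ h => (Prod.ext_iff.1 h).1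

lemma coveringSum_le_diamSum_graphOn {δ : ℝ} {r : Plane → ℝ} {T Q A : Set Plane}
    (hT : T.Countable) (hr : ∀ x ∈ T, 0 < r x ∧ r x < δ / 2) (hTQ : T ⊆ Q)
    (hA : A ⊆ ⋃ x ∈ T, Metric.closedBall x (r x)) :
    coveringSum δ Q A ≤ diamSum dimS (T.graphOn r) :=
  iInf₂_le _ ⟨isFineFamily_graphOn hT hr, forall_mem_image.2 fun _ hx => hTQ hx, by
    rwa [Covers, graphOn, biUnion_image]⟩

lemma mul_centredPre_le [IsFiniteMeasure ν] {E : Set Plane}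
    (hE : ∀ x ∈ E, ∃ᶠ d in 𝓝[>] (0 : ℝ), κ ≤ density ν x d) :
    κ * centredPre dimS E ≤ ν E := by
  rw [centredPre_eq, coveringPre]
  simp only [ENNReal.mul_iSup]
  refine iSup₂_le fun δ hδ => ENNReal.le_of_forall_pos_le_add fun ε hε _ => ?_
  obtain ⟨T, r, hT, hTE, hr, h_cover, h_sum⟩ :=
    Besicovitch.exists_closedBall_covering_tsum_measure_le ν (ENNReal.coe_pos.2 hε).ne'
      (fun x => {d | κ ≤ density ν x d} ∩ Ioo 0 (δ / 2)) E fun x hx η hη =>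
        (((hE x hx).and_eventually (Ioo_mem_nhdsGT (half_pos hδ))).and_eventually
          (Ioo_mem_nhdsGT hη)).exists
  calc κ * coveringSum δ E E ≤ κ * diamSum dimS (T.graphOn r) := by
        gcongr
        exact coveringSum_le_diamSum_graphOn hT (fun x hx => (hr x hx).2) hTE h_cover
    _ = ∑' x : T, κ * diamPow (r x) := by rw [diamSum_graphOn, ENNReal.tsum_mul_left]
    _ ≤ ∑' x : T, ν (Metric.closedBall x (r x)) := ENNReal.tsum_le_tsum fun x =>
        (le_density_iff (hr x x.2).2.1).1 (hr x x.2).1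
    _ ≤ ν E + ε := h_sum

lemma mul_packingPre_le {F : Set Plane} {ρ : ℝ} (hρ : 0 < ρ)
    (h : ∀ x ∈ F, ∀ d, 0 < d → d ≤ ρ → κ ≤ density ν x d) :
    κ * packingPre dimS F ≤ ν (Metric.cthickening ρ F) := by
  refine (mul_le_mul_right (iInf₂_le ρ hρ) κ).trans ?_
  simp only [ENNReal.mul_iSup]
  refine iSup₂_le fun t ht => ?_
  have h_radius (p) (hp : p ∈ t) : 0 < p.2 ∧ p.2 ≤ ρ :=
    ⟨(ht.1.2 p hp).1, by linarith [ht.1.2 p hp]⟩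
  calc κ * diamSum dimS t = ∑' p : t, κ * diamPow (p : Plane × ℝ).2 := ENNReal.tsum_mul_left.symm
    _ ≤ ∑' p : t, ν (Metric.closedBall (p : Plane × ℝ).1 (p : Plane × ℝ).2) :=
        ENNReal.tsum_le_tsum fun p => (le_density_iff (h_radius p p.2).1).1
          (h _ (ht.2.1 p p.2) _ (h_radius p p.2).1 (h_radius p p.2).2)
    _ = ν (⋃ p ∈ t, Metric.closedBall p.1 p.2) :=
        (measure_biUnion ht.1.1 ht.2.2 fun _ _ => Metric.isClosed_closedBall.measurableSet).symm
    _ ≤ ν (Metric.cthickening ρ F) := measure_mono <| iUnion₂_subset fun p hp =>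
        (Metric.closedBall_subset_closedBall (h_radius p hp).2).trans
          (Metric.closedBall_subset_cthickening (ht.2.1 p hp) ρ)

lemma le_mul_packingPre [IsFiniteMeasure ν] (hκ : κ ≠ 0) (hκ' : κ ≠ ⊤) {E : Set Plane}
    (hE : ∀ x ∈ E, ∃ᶠ d in 𝓝[>] (0 : ℝ), density ν x d ≤ κ) :
    ν E ≤ κ * packingPre dimS E := by
  rw [packingPre]
  simp only [ENNReal.mul_iInf_of_ne hκ hκ']
  refine le_iInf₂ fun δ hδ => ?_
  obtain ⟨T, r, hT, hTE, hr, h_ae, h_disjoint⟩ :=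
    Besicovitch.exists_disjoint_closedBall_covering_ae ν (fun x => {d | density ν x d ≤ κ}) E
      (fun x hx η hη => ((hE x hx).and_eventually (Ioo_mem_nhdsGT hη)).exists)
      (fun _ => δ / 2) fun _ _ => half_pos hδ
  calc ν E ≤ ν (⋃ x ∈ T, Metric.closedBall x (r x)) :=
        measure_mono_ae (ae_le_set.2 h_ae)
    _ ≤ ∑' x : T, ν (Metric.closedBall x (r x)) := measure_biUnion_le ν hT _
    _ ≤ ∑' x : T, κ * diamPow (r x) := ENNReal.tsum_le_tsum fun x =>
        (density_le_iff (hr x x.2).2.1).1 (hr x x.2).1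
    _ = κ * diamSum dimS (T.graphOn r) := by rw [diamSum_graphOn, ENNReal.tsum_mul_left]
    _ ≤ _ := by
        gcongr κ * ?_
        refine le_iSup₂_of_le _ ⟨isFineFamily_graphOn hT fun x hx => (hr x hx).2,
          forall_mem_image.2 fun _ hx => hTE hx, ?_⟩ le_rfl
        exact (InjOn.pairwiseDisjoint_image fun _ _ _ _ h => (Prod.ext_iff.1 h).1).2 h_disjoint

end Density

/-- The part of the gasket at distance at least `r` from the vertices, on which the balls of small
radius are uniformly typical. -/
def innerPart (r : ℝ) : Set Plane := gasket \ ⋃ i, Metric.ball (vertex i) r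

/-- The part of the gasket at distance at most `r` from the vertices. -/
def cornerPart (r : ℝ) : Set Plane := gasket ∩ ⋃ i, Metric.closedBall (vertex i) r

lemma isClosed_innerPart (r : ℝ) : IsClosed (innerPart r) :=
  isClosed_gasket.sdiff (isOpen_iUnion fun _ => Metric.isOpen_ball)

lemma isClosed_cornerPart (r : ℝ) : IsClosed (cornerPart r) :=
  isClosed_gasket.inter (isClosed_iUnion_of_finite fun _ => Metric.isClosed_closedBall)

lemma gasket_subset_innerPart_union_cornerPart (r : ℝ) :
    gasket ⊆ innerPart r ∪ cornerPart r := by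
  rw [innerPart, cornerPart, ← sdiff_subset_iff, sdiff_sdiff_right_self]
  exact inter_subset_inter_right _ (iUnion_mono fun i => Metric.ball_subset_closedBall)

lemma exists_isTypical_of_mem_innerPart {r : ℝ} (hr : 0 < r) :
    ∃ ρ > 0, ∀ x ∈ innerPart r, ∀ d, 0 < d → d ≤ ρ → IsTypical x d := by
  have h_subset : innerPart r ⊆ hexagon := fun x hx => mem_hexagon_of_mem_gasket hx.1 fun i hi =>
    hx.2 (mem_iUnion.2 ⟨i, hi ▸ Metric.mem_ball_self hr⟩)
  have h_compact : IsCompact (innerPart r) :=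
    isCompact_gasket.of_isClosed_subset (isClosed_innerPart r) sdiff_subset
  obtain ⟨ρ, hρ, hρ'⟩ := h_compact.exists_cthickening_subset_open isOpen_hexagon h_subset
  exact ⟨ρ, hρ, fun x hx d hd hdρ => ⟨hx.1, hd, hexagon, isFeasible_hexagon,
    (Metric.closedBall_subset_closedBall hdρ).trans
      ((Metric.closedBall_subset_cthickening hx ρ).trans hρ')⟩⟩

lemma cthickening_cornerPart_subset {r : ℝ} (hr : 0 ≤ r) :
    Metric.cthickening r (cornerPart r) ⊆ ⋃ i, Metric.closedBall (vertex i) (2 * r) := by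
  rw [(isCompact_gasket.of_isClosed_subset (isClosed_cornerPart r)
    inter_subset_left).cthickening_eq_biUnion_closedBall hr]
  refine iUnion₂_subset fun x hx => ?_
  obtain ⟨i, hi⟩ := mem_iUnion.1 hx.2
  refine subset_iUnion_of_subset i (Metric.closedBall_subset_closedBall' ?_)
  linarith [Metric.mem_closedBall.1 hi]

namespace IsSelfSimilar

variable {ν : Measure Plane}

lemma tendsto_measure_iUnion_closedBall_vertex (hν : IsSelfSimilar ν) :
    Tendsto (fun n : ℕ => ν (⋃ i, Metric.closedBall (vertex i) ((1 / 2) ^ n))) atTop (𝓝 0) := by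
  have h_le (n : ℕ) :
      ν (⋃ i, Metric.closedBall (vertex i) ((1 / 2) ^ n)) ≤ 3 * (3⁻¹ ^ n * ν gasket) := by
    refine (measure_iUnion_fintype_le ν _).trans_eq ?_
    simp only [hν.measure_closedBall_vertex _ (by positivity : (0 : ℝ) < (1 / 2) ^ n),
      hν.measure_closedBall_vertex_pow, Finset.sum_const, Finset.card_univ, Fintype.card_fin,
      nsmul_eq_mul, Nat.cast_ofNat]
  have h_pow : Tendsto (fun n : ℕ => (3⁻¹ : ℝ≥0∞) ^ n) atTop (𝓝 0) :=
    ENNReal.tendsto_pow_atTop_nhds_zero_of_lt_one (by simp)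
  have h_tendsto := ENNReal.Tendsto.const_mul (a := 3)
    (ENNReal.Tendsto.mul_const h_pow (Or.inr (hν.measure_ne_top gasket))) (Or.inr (by simp))
  rw [zero_mul, mul_zero] at h_tendsto
  exact tendsto_of_tendsto_of_tendsto_of_le_of_le tendsto_const_nhds h_tendsto
    (fun _ => zero_le) h_le

lemma ne_zero_of_mem_typicalDensities (hν : IsSelfSimilar ν) {l : ℝ≥0∞}
    (hl : l ∈ typicalDensities ν) : l ≠ 0 := by
  obtain ⟨x, d, h, rfl⟩ := hl
  exact (hν.density_pos h.1 h.2.1).ne'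

lemma ne_top_of_mem_typicalDensities (hν : IsSelfSimilar ν) {l : ℝ≥0∞}
    (hl : l ∈ typicalDensities ν) : l ≠ ⊤ := by
  obtain ⟨x, d, h, rfl⟩ := hl
  exact hν.density_ne_top h.2.1

lemma measure_gasket_le_mul_centredHausdorff (hν : IsSelfSimilar ν) {b : ℝ≥0∞}
    (hb : IsGreatest (typicalDensities ν) b) :
    ν gasket ≤ b * centredHausdorff dimS gasket := by
  have h_inner (r : ℝ) (hr : 0 < r) :
      ν (innerPart r) ≤ b * centredHausdorff dimS gasket := by
    obtain ⟨ρ, hρ, h⟩ := exists_isTypical_of_mem_innerPart hr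
    refine (measure_le_mul_coveringPre (hν.ne_zero_of_mem_typicalDensities hb.1)
      (hν.ne_top_of_mem_typicalDensities hb.1) (Q := innerPart r) hρ fun x hx d hd hdρ =>
        (density_le_iff hd).1 (hb.2 ⟨x, d, h x hx d hd hdρ, rfl⟩)).trans ?_
    gcongr
    exact centredPre_le_centredHausdorff (isClosed_innerPart r) sdiff_subset
  have h_tendsto := hν.tendsto_measure_iUnion_closedBall_vertex.const_add
    (b * centredHausdorff dimS gasket)
  rw [add_zero] at h_tendsto
  refine ge_of_tendsto' h_tendsto fun n => ?_
  refine (measure_mono (gasket_subset_innerPart_union_cornerPart ((1 / 2) ^ n))).trans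
    ((measure_union_le _ _).trans ?_)
  gcongr
  exacts [h_inner _ (by positivity), inter_subset_right]

lemma exists_pos_le_density (hν : IsSelfSimilar ν) :
    ∃ c : ℝ≥0∞, c ≠ 0 ∧ c ≠ ⊤ ∧ ∀ x ∈ gasket, ∀ d, 0 < d → d ≤ 1 → c ≤ density ν x d :=
  ⟨3⁻¹ * ν gasket / 3, by simp [hν.measure_pos.ne'],
    ENNReal.div_ne_top (ENNReal.mul_ne_top (by simp) (hν.measure_ne_top _)) (by simp),
    fun _ hx _ hd hd₁ => hν.le_density hx hd hd₁⟩

lemma centredPre_eq_zero (hν : IsSelfSimilar ν) {E : Set Plane} (hE : E ⊆ gasket)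
    (hE₀ : ν E = 0) : centredPre dimS E = 0 := by
  have := hν.isFiniteMeasure
  obtain ⟨c, hc, -, h⟩ := hν.exists_pos_le_density
  have h_le : c * centredPre dimS E ≤ 0 := hE₀ ▸ mul_centredPre_le fun x hx =>
    Eventually.frequently <| by
      filter_upwards [Ioc_mem_nhdsGT one_pos] with d hd using h x (hE hx) d hd.1 hd.2
  exact (mul_eq_zero.1 (le_zero_iff.1 h_le)).resolve_left hc

lemma mul_centredHausdorff_le_measure_gasket (hν : IsSelfSimilar ν) {b : ℝ≥0∞}
    (hb : b ∈ typicalDensities ν) : b * centredHausdorff dimS gasket ≤ ν gasket := by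
  have := hν.isFiniteMeasure
  have h_closed {F : Set Plane} (hF : F ⊆ gasket) {b' : ℝ≥0∞} (hb' : b' < b) :
      b' * centredPre dimS F ≤ ν gasket := by
    have h_frequently (x) (hx : x ∈ F ∩ denseOrbitPoints) :
        ∃ᶠ d in 𝓝[>] (0 : ℝ), b' ≤ density ν x d :=
      ((mem_densitySpectrum_singleton.1 (hν.typicalDensities_subset_densitySpectrum hx.2 hb)
        ).frequently (Ioi_mem_nhds hb')).mono fun d hd => le_of_lt hd
    calc b' * centredPre dimS F
        ≤ b' * (centredPre dimS (F ∩ denseOrbitPoints)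
          + centredPre dimS (F \ denseOrbitPoints)) := by
          gcongr
          simp only [centredPre_eq]
          simpa only [inter_union_sdiff] using coveringPre_union_le (F ∩ denseOrbitPoints)
            (F \ denseOrbitPoints) (F ∩ denseOrbitPoints) (F \ denseOrbitPoints)
      _ = b' * centredPre dimS (F ∩ denseOrbitPoints) := by
          rw [hν.centredPre_eq_zero (sdiff_subset.trans hF) (measure_mono_null
            (sdiff_subset_sdiff_left hF) hν.measure_diff_denseOrbitPoints), add_zero]
      _ ≤ ν (F ∩ denseOrbitPoints) := mul_centredPre_le h_frequently
      _ ≤ ν gasket := hν.le_measure_gasket _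
  refine ENNReal.mul_le_of_forall_lt fun b' hb' c hc => ?_
  simp only [centredHausdorff, lt_iSup_iff, exists_prop] at hc
  obtain ⟨F, hF, hcF⟩ := hc
  exact (mul_le_mul_right hcF.le b').trans (h_closed hF.1 hb')

lemma mul_centredHausdorff_eq (hν : IsSelfSimilar ν) {b : ℝ≥0∞}
    (hb : IsGreatest (typicalDensities ν) b) :
    b * centredHausdorff dimS gasket = ν gasket :=
  (hν.mul_centredHausdorff_le_measure_gasket hb.1).antisymm
    (hν.measure_gasket_le_mul_centredHausdorff hb)

lemma tendsto_packingPre_cornerPart (hν : IsSelfSimilar ν) :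
    Tendsto (fun n : ℕ => packingPre dimS (cornerPart ((1 / 2) ^ (n + 1)))) atTop (𝓝 0) := by
  obtain ⟨c, hc, hc', h⟩ := hν.exists_pos_le_density
  have h_le (n : ℕ) : packingPre dimS (cornerPart ((1 / 2) ^ (n + 1)))
      ≤ ν (⋃ i, Metric.closedBall (vertex i) ((1 / 2) ^ n)) / c := by
    have h_pos : (0 : ℝ) < (1 / 2) ^ (n + 1) := by positivity
    have h_two : 2 * (1 / 2 : ℝ) ^ (n + 1) = (1 / 2) ^ n := by rw [pow_succ]; ring
    rw [ENNReal.le_div_iff_mul_le (Or.inl hc) (Or.inl hc'), mul_comm, ← h_two]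
    exact (mul_packingPre_le h_pos fun x hx d hd hdr => h x hx.1 d hd
      (hdr.trans (pow_le_one₀ (by norm_num) (by norm_num)))).trans
        (measure_mono (cthickening_cornerPart_subset h_pos.le))
  have h_tendsto := ENNReal.Tendsto.div_const hν.tendsto_measure_iUnion_closedBall_vertex
    (b := c) (Or.inr hc)
  rw [ENNReal.zero_div] at h_tendsto
  exact tendsto_of_tendsto_of_tendsto_of_le_of_le tendsto_const_nhds h_tendsto
    (fun _ => zero_le) h_le

lemma mul_packing_le_measure_gasket (hν : IsSelfSimilar ν) {a : ℝ≥0∞}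
    (ha : IsLeast (typicalDensities ν) a) : a * packing dimS gasket ≤ ν gasket := by
  have h_inner (r : ℝ) (hr : 0 < r) : a * packingPre dimS (innerPart r) ≤ ν gasket := by
    obtain ⟨ρ, hρ, h⟩ := exists_isTypical_of_mem_innerPart hr
    exact (mul_packingPre_le hρ fun x hx d hd hdρ => ha.2 ⟨x, d, h x hx d hd hdρ, rfl⟩).trans
      (hν.le_measure_gasket _)
  have h_tendsto := (ENNReal.Tendsto.const_mul (a := a) hν.tendsto_packingPre_cornerPart
    (Or.inr (hν.ne_top_of_mem_typicalDensities ha.1))).const_add (ν gasket)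
  rw [mul_zero, add_zero] at h_tendsto
  refine ge_of_tendsto' h_tendsto fun n => ?_
  set r : ℝ := (1 / 2) ^ (n + 1)
  calc a * packing dimS gasket
      ≤ a * (packing dimS (innerPart r) + packing dimS (cornerPart r)) := by
        simp only [packing_eq_inducedOuterMeasure]
        gcongr
        exact (measure_mono (gasket_subset_innerPart_union_cornerPart r)).trans
          (measure_union_le _ _)
    _ ≤ a * packingPre dimS (innerPart r) + a * packingPre dimS (cornerPart r) := by
        rw [mul_add]
        gcongr
        exacts [packing_le_packingPre (isClosed_innerPart r),
          packing_le_packingPre (isClosed_cornerPart r)]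
    _ ≤ ν gasket + a * packingPre dimS (cornerPart r) := by
        gcongr
        exact h_inner r (by positivity)

lemma measure_gasket_le_mul_packing (hν : IsSelfSimilar ν) {a : ℝ≥0∞}
    (ha : a ∈ typicalDensities ν) : ν gasket ≤ a * packing dimS gasket := by
  have := hν.isFiniteMeasure
  have h_pre {a' : ℝ≥0∞} (ha' : a < a') (ha'_top : a' ≠ ⊤) (F : Set Plane) :
      ν F ≤ a' * packingPre dimS F := by
    have h_frequently (x) (hx : x ∈ F ∩ denseOrbitPoints) :
        ∃ᶠ d in 𝓝[>] (0 : ℝ), density ν x d ≤ a' :=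
      ((mem_densitySpectrum_singleton.1 (hν.typicalDensities_subset_densitySpectrum hx.2 ha)
        ).frequently (Iio_mem_nhds ha')).mono fun d hd => le_of_lt hd
    calc ν F = ν (F ∩ denseOrbitPoints) := (hν.measure_inter_denseOrbitPoints F).symm
      _ ≤ a' * packingPre dimS (F ∩ denseOrbitPoints) :=
          le_mul_packingPre (pos_of_gt ha').ne' ha'_top h_frequently
      _ ≤ a' * packingPre dimS F := by
          gcongr
          exact packingPre_mono inter_subset_left
  refine ENNReal.le_mul_of_forall_lt (Or.inl (hν.ne_zero_of_mem_typicalDensities ha))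
    (Or.inl (hν.ne_top_of_mem_typicalDensities ha)) fun a' ha' c hc => ?_
  rcases eq_or_ne a' ⊤ with rfl | ha'_top
  · rw [ENNReal.top_mul (pos_of_gt hc).ne']
    exact le_top
  simp only [packing, gt_iff_lt, iInf_lt_iff, exists_prop] at hc
  obtain ⟨F, hF, hcF⟩ := hc
  calc ν gasket ≤ ∑' n, ν (F n) := (measure_mono hF.2).trans (measure_iUnion_le F)
    _ ≤ ∑' n, a' * packingPre dimS (F n) := ENNReal.tsum_le_tsum fun n => h_pre ha' ha'_top (F n)
    _ = a' * ∑' n, packingPre dimS (F n) := ENNReal.tsum_mul_left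
    _ ≤ a' * c := by gcongr

lemma mul_packing_eq (hν : IsSelfSimilar ν) {a : ℝ≥0∞} (ha : IsLeast (typicalDensities ν) a) :
    a * packing dimS gasket = ν gasket :=
  (hν.mul_packing_le_measure_gasket ha).antisymm (hν.measure_gasket_le_mul_packing ha.1)

end IsSelfSimilar

/-! ### Existence of the natural measure -/

/-- The uniform distribution on the three letters. -/
def uniformLetter : Measure (Fin 3) := (PMF.uniformOfFintype (Fin 3)).toMeasure

instance : IsProbabilityMeasure uniformLetter :=
  inferInstanceAs (IsProbabilityMeasure (PMF.uniformOfFintype (Fin 3)).toMeasure)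

open scoped Classical in
lemma uniformLetter_apply (A : Set (Fin 3)) : uniformLetter A = ∑ i, if i ∈ A then 3⁻¹ else 0 := by
  simp only [uniformLetter, PMF.toMeasure_apply_fintype, indicator_apply,
    PMF.uniformOfFintype_apply, Fintype.card_fin, Nat.cast_ofNat]

/-- The uniform Bernoulli measure on infinite words, whose image under the coding is the natural
measure. -/
def bernoulli : Measure (ℕ → Fin 3) := Measure.infinitePi fun _ => uniformLetter

instance : IsProbabilityMeasure bernoulli :=
  inferInstanceAs (IsProbabilityMeasure (Measure.infinitePi fun _ => uniformLetter))

/-- The infinite word with first letter `i` followed by the word `ω`. -/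
def consLetter (i : Fin 3) (ω : ℕ → Fin 3) : ℕ → Fin 3 := fun n => Nat.casesOn n i ω

lemma measurable_consLetter (i : Fin 3) : Measurable (consLetter i) := by
  refine measurable_pi_iff.2 fun n => ?_
  cases n with
  | zero => exact measurable_const
  | succ n => exact measurable_pi_apply n

lemma consLetter_mem_pi_iff {i : Fin 3} {ω : ℕ → Fin 3} {s : Set ℕ} {t : ℕ → Set (Fin 3)} :
    consLetter i ω ∈ s.pi t ↔
      (0 ∈ s → i ∈ t 0) ∧ ω ∈ (Nat.succ ⁻¹' s).pi fun n => t (n + 1) :=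
  ⟨fun h => ⟨h 0, fun n => h (n + 1)⟩, fun h n => Nat.casesOn n h.1 h.2⟩

open scoped Classical in
lemma bernoulli_preimage_consLetter_pi (i : Fin 3) (s : Finset ℕ) (t : ℕ → Set (Fin 3)) :
    bernoulli (consLetter i ⁻¹' (s : Set ℕ).pi t)
      = if 0 ∈ s → i ∈ t 0 then ∏ n ∈ s.erase 0, uniformLetter (t n) else 0 := by
  split_ifs with hi
  · have h_pre : consLetter i ⁻¹' (s : Set ℕ).pi t
        = (((s.erase 0).preimage Nat.succ Nat.succ_injective.injOn : Finset ℕ) : Set ℕ).pi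
          fun n => t (n + 1) := by
      ext ω
      rw [mem_preimage, consLetter_mem_pi_iff, Finset.mem_coe, and_iff_right hi]
      simp
    rw [h_pre, bernoulli, Measure.infinitePi_pi _ fun _ _ => MeasurableSet.of_discrete]
    refine Finset.prod_preimage Nat.succ _ _ (fun n => uniformLetter (t n)) fun n hn hn' => ?_
    exact absurd (Nat.exists_eq_succ_of_ne_zero (Finset.ne_of_mem_erase hn))
      fun ⟨m, hm⟩ => hn' ⟨m, hm.symm⟩
  · rw [(eq_empty_of_forall_notMem fun ω hω => hi (consLetter_mem_pi_iff.1 hω).1 :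
      consLetter i ⁻¹' (s : Set ℕ).pi t = ∅), measure_empty]

lemma bernoulli_eq_sum : bernoulli = ∑ i : Fin 3, (3⁻¹ : ℝ≥0∞) • bernoulli.map (consLetter i) := by
  classical
  refine (Measure.eq_infinitePi _ fun s t ht => ?_).symm
  have h_meas : MeasurableSet ((s : Set ℕ).pi t) :=
    MeasurableSet.pi s.countable_toSet fun n _ => ht n
  simp only [Measure.finsetSum_apply, Measure.smul_apply, smul_eq_mul,
    Measure.map_apply (measurable_consLetter _) h_meas, bernoulli_preimage_consLetter_pi]
  by_cases h0 : 0 ∈ s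
  · rw [← Finset.mul_prod_erase s _ h0, uniformLetter_apply, Finset.sum_mul]
    simp only [h0, true_imp_iff, ite_mul, mul_ite, zero_mul, mul_zero]
  · simp only [h0, false_imp_iff, if_true, Finset.erase_eq_of_notMem h0, Finset.sum_const,
      Finset.card_univ, Fintype.card_fin, nsmul_eq_mul, Nat.cast_ofNat]
    rw [← mul_assoc, ENNReal.mul_inv_cancel (by simp) (by simp), one_mul]

lemma norm_vertex_le (i : Fin 3) : ‖vertex i‖ ≤ 1 := by
  have h_zero : vertex 0 = 0 := by ext j; fin_cases j <;> simp [vertex]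
  simpa only [h_zero, dist_zero_right] using dist_le_one (vertex_mem_gasket i) (vertex_mem_gasket 0)

/-- The point `π(ω)` coded by `ω`, written as the sum of its dyadic expansion in the vertices. -/
def codePoint (ω : ℕ → Fin 3) : Plane := ∑' n, (1 / 2 : ℝ) ^ (n + 1) • vertex (ω n)

lemma hasSum_half_pow_succ : HasSum (fun n : ℕ => (1 / 2 : ℝ) ^ (n + 1)) 1 := by
  simpa only [← pow_succ', one_div_mul_cancel (two_ne_zero' ℝ)]
    using hasSum_geometric_two.mul_left (1 / 2 : ℝ)

lemma norm_half_pow_smul_vertex_le (ω : ℕ → Fin 3) (n : ℕ) :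
    ‖(1 / 2 : ℝ) ^ (n + 1) • vertex (ω n)‖ ≤ (1 / 2) ^ (n + 1) := by
  rw [norm_smul, Real.norm_of_nonneg (by positivity)]
  exact mul_le_of_le_one_right (by positivity) (norm_vertex_le _)

lemma summable_codePoint (ω : ℕ → Fin 3) :
    Summable fun n => (1 / 2 : ℝ) ^ (n + 1) • vertex (ω n) :=
  Summable.of_norm_bounded hasSum_half_pow_succ.summable (norm_half_pow_smul_vertex_le ω)

lemma norm_codePoint_le (ω : ℕ → Fin 3) : ‖codePoint ω‖ ≤ 1 :=
  tsum_of_norm_bounded hasSum_half_pow_succ (norm_half_pow_smul_vertex_le ω)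

lemma codePoint_consLetter (i : Fin 3) (ω : ℕ → Fin 3) :
    codePoint (consLetter i ω) = simil i (codePoint ω) := by
  rw [codePoint, (summable_codePoint _).tsum_eq_zero_add, simil, codePoint,
    ← (summable_codePoint ω).tsum_const_smul, add_comm]
  congr 1
  · refine tsum_congr fun n => ?_
    rw [smul_smul, ← pow_succ']
    rfl
  · simp [consLetter]

lemma measurable_codePoint : Measurable codePoint := by
  refine measurable_of_tendsto_metrizable (f := fun N ω =>
    ∑ n ∈ Finset.range N, (1 / 2 : ℝ) ^ (n + 1) • vertex (ω n)) (fun N => ?_) ?_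
  · exact Finset.measurable_sum _ fun n _ =>
      (measurable_of_finite fun i => (1 / 2 : ℝ) ^ (n + 1) • vertex i).comp (measurable_pi_apply n)
  · exact tendsto_pi_nhds.2 fun ω => (summable_codePoint ω).hasSum.tendsto_sum_nat

lemma exists_isNaturalMeasure : ∃ μ : Measure Plane, IsNaturalMeasure μ := by
  refine ⟨bernoulli.map codePoint,
    Measure.isProbabilityMeasure_map measurable_codePoint.aemeasurable,
    ⟨Metric.closedBall 0 1, isCompact_closedBall _ _, ?_⟩, ?_⟩
  · have h_pre : codePoint ⁻¹' (Metric.closedBall 0 1)ᶜ = ∅ :=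
      eq_empty_of_forall_notMem fun ω h => h (mem_closedBall_zero_iff.2 (norm_codePoint_le ω))
    rw [Measure.map_apply measurable_codePoint Metric.isClosed_closedBall.measurableSet.compl,
      h_pre, measure_empty]
  · have h_comp (i : Fin 3) : codePoint ∘ consLetter i = simil i ∘ codePoint :=
      funext (codePoint_consLetter i)
    conv_lhs => rw [bernoulli_eq_sum]
    simp only [ofReal_half_rpow_dimS, Measure.map_finset_sum measurable_codePoint.aemeasurable,
      Measure.map_smul, Measure.map_map measurable_codePoint (measurable_consLetter _),
      Measure.map_map (continuous_simil _).measurable measurable_codePoint, h_comp]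

lemma IsNaturalMeasure.measure_lt_infDist_le {μ : Measure Plane} (hμ : IsNaturalMeasure μ)
    (ε : ℝ) : μ {x | ε < Metric.infDist x gasket} ≤ μ {x | 2 * ε < Metric.infDist x gasket} := by
  set E : Set Plane := {x | ε < Metric.infDist x gasket}
  set E' : Set Plane := {x | 2 * ε < Metric.infDist x gasket}
  have hE : MeasurableSet E :=
    (isOpen_lt continuous_const (Metric.continuous_infDist_pt _)).measurableSet
  have h_pre (i : Fin 3) : simil i ⁻¹' E ⊆ E' := fun x (hx : ε < _) =>
    show 2 * ε < _ by linarith [infDist_simil_le_half (fun _ => simil_mem_gasket i) x]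
  calc μ E = ∑ i : Fin 3, 3⁻¹ * μ (simil i ⁻¹' E) := by
        conv_lhs => rw [hμ.2.2]
        simp only [ofReal_half_rpow_dimS, Measure.finsetSum_apply, Measure.smul_apply, smul_eq_mul,
          Measure.map_apply (continuous_simil _).measurable hE]
    _ ≤ ∑ _i : Fin 3, 3⁻¹ * μ E' := by gcongr with i; exact h_pre i
    _ = μ E' := by
        rw [Finset.sum_const, Finset.card_univ, Fintype.card_fin, nsmul_eq_mul, ← mul_assoc,
          Nat.cast_ofNat, ENNReal.mul_inv_cancel (by simp) (by simp), one_mul]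

lemma IsNaturalMeasure.measure_lt_infDist_eq_zero {μ : Measure Plane} (hμ : IsNaturalMeasure μ)
    {ε : ℝ} (hε : 0 < ε) : μ {x | ε < Metric.infDist x gasket} = 0 := by
  have h_iterate (k : ℕ) :
      μ {x | ε < Metric.infDist x gasket} ≤ μ {x | 2 ^ k * ε < Metric.infDist x gasket} := by
    induction k with
    | zero => simp
    | succ k ih => rw [pow_succ', mul_assoc]; exact ih.trans (hμ.measure_lt_infDist_le _)
  obtain ⟨K, hK, hK_compl⟩ := hμ.2.1
  obtain ⟨R, hR⟩ := (hK.image (Metric.continuous_infDist_pt gasket)).bddAbove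
  obtain ⟨k, hk⟩ := pow_unbounded_of_one_lt (R / ε) (one_lt_two (α := ℝ))
  rw [div_lt_iff₀ hε] at hk
  have h_far : {x | 2 ^ k * ε < Metric.infDist x gasket} ⊆ Kᶜ := fun x hx hxK =>
    (hR (mem_image_of_mem _ hxK)).not_gt (hk.trans hx)
  exact measure_mono_null h_far hK_compl |> (h_iterate k).trans_eq |> le_zero_iff.1

lemma IsNaturalMeasure.measure_compl_gasket {μ : Measure Plane} (hμ : IsNaturalMeasure μ) :
    μ gasketᶜ = 0 := by
  have h_cover : gasketᶜ ⊆ ⋃ n : ℕ, {x | 1 / ((n : ℝ) + 1) < Metric.infDist x gasket} :=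
    fun x hx => mem_iUnion.2 <|
      exists_nat_one_div_lt ((isClosed_gasket.notMem_iff_infDist_pos gasket_nonempty).1 hx)
  exact measure_mono_null h_cover
    (measure_iUnion_null fun _ => hμ.measure_lt_infDist_eq_zero Nat.one_div_pos_of_nat)

lemma IsNaturalMeasure.measure_gasket {μ : Measure Plane} (hμ : IsNaturalMeasure μ) :
    μ gasket = 1 :=
  have := hμ.1
  (prob_compl_eq_zero_iff isClosed_gasket.measurableSet).1 hμ.measure_compl_gasket

lemma IsNaturalMeasure.isSelfSimilar {μ : Measure Plane} (hμ : IsNaturalMeasure μ) :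
    IsSelfSimilar μ where
  isFiniteMeasure := have := hμ.1; inferInstance
  measure_compl := hμ.measure_compl_gasket
  measure_pos := hμ.measure_gasket ▸ one_pos
  eq_sum := by simpa only [ofReal_half_rpow_dimS] using hμ.2.2

/-! ### The metric measures of the gasket -/

namespace IsSelfSimilar

variable {ν : Measure Plane}

lemma smul (hν : IsSelfSimilar ν) {c : ℝ≥0∞} (hc : c ≠ 0) (hc' : c ≠ ⊤) :
    IsSelfSimilar (c • ν) where
  isFiniteMeasure := have := hν.isFiniteMeasure; Measure.smul_finite ν hc'
  measure_compl := by rw [Measure.smul_apply, hν.measure_compl, smul_zero]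
  measure_pos := ENNReal.mul_pos hc hν.measure_pos.ne'
  eq_sum := by
    conv_lhs => rw [hν.eq_sum]
    simp only [Measure.map_smul, Finset.smul_sum, smul_comm c]

lemma exists_isGreatest_typicalDensities (hν : IsSelfSimilar ν) :
    ∃ b, IsGreatest (typicalDensities ν) b :=
  hν.isCompact_typicalDensities.exists_isGreatest (typicalDensities_nonempty _)

lemma exists_isLeast_typicalDensities (hν : IsSelfSimilar ν) :
    ∃ a, IsLeast (typicalDensities ν) a :=
  hν.isCompact_typicalDensities.exists_isLeast (typicalDensities_nonempty _)

lemma centredHausdorff_pos_lt_top (hν : IsSelfSimilar ν) :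
    0 < centredHausdorff dimS gasket ∧ centredHausdorff dimS gasket < ⊤ := by
  obtain ⟨b, hb⟩ := hν.exists_isGreatest_typicalDensities
  have h_mul := hν.mul_centredHausdorff_eq hb
  have h_ne_zero : centredHausdorff dimS gasket ≠ 0 :=
    right_ne_zero_of_mul (h_mul ▸ hν.measure_pos.ne')
  refine ⟨pos_iff_ne_zero.2 h_ne_zero, lt_top_iff_ne_top.2 fun h_top => ?_⟩
  rw [h_top, ENNReal.mul_top (hν.ne_zero_of_mem_typicalDensities hb.1)] at h_mul
  exact hν.measure_ne_top _ h_mul.symm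

lemma packing_pos_lt_top (hν : IsSelfSimilar ν) :
    0 < packing dimS gasket ∧ packing dimS gasket < ⊤ := by
  obtain ⟨a, ha⟩ := hν.exists_isLeast_typicalDensities
  have h_mul := hν.mul_packing_eq ha
  have h_ne_zero : packing dimS gasket ≠ 0 := right_ne_zero_of_mul (h_mul ▸ hν.measure_pos.ne')
  refine ⟨pos_iff_ne_zero.2 h_ne_zero, lt_top_iff_ne_top.2 fun h_top => ?_⟩
  rw [h_top, ENNReal.mul_top (hν.ne_zero_of_mem_typicalDensities ha.1)] at h_mul
  exact hν.measure_ne_top _ h_mul.symm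

lemma isGreatest_typicalDensities (hν : IsSelfSimilar ν) :
    IsGreatest (typicalDensities ν) (ν gasket / centredHausdorff dimS gasket) := by
  obtain ⟨b, hb⟩ := hν.exists_isGreatest_typicalDensities
  obtain ⟨h_pos, h_lt_top⟩ := hν.centredHausdorff_pos_lt_top
  rwa [← hν.mul_centredHausdorff_eq hb, ENNReal.mul_div_cancel_right h_pos.ne' h_lt_top.ne]

lemma isLeast_typicalDensities (hν : IsSelfSimilar ν) :
    IsLeast (typicalDensities ν) (ν gasket / packing dimS gasket) := by
  obtain ⟨a, ha⟩ := hν.exists_isLeast_typicalDensities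
  obtain ⟨h_pos, h_lt_top⟩ := hν.packing_pos_lt_top
  rwa [← hν.mul_packing_eq ha, ENNReal.mul_div_cancel_right h_pos.ne' h_lt_top.ne]

lemma measure_le_mul_ediam_rpow (hν : IsSelfSimilar ν) {b : ℝ≥0∞}
    (hb : b ∈ upperBounds (typicalDensities ν)) {A : Set Plane}
    (hA : Metric.ediam A ≤ ENNReal.ofReal (2 / 5)) : ν A ≤ b * (3 * Metric.ediam A ^ dimS) := by
  rw [← hν.measure_inter_gasket]
  rcases (A ∩ gasket).eq_empty_or_nonempty with h_empty | ⟨x, hxA, hx⟩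
  · simp [h_empty]
  have h_ne_top : Metric.ediam A ≠ ⊤ := ne_top_of_le_ne_top ENNReal.ofReal_ne_top hA
  rcases eq_or_ne (Metric.ediam A) 0 with h_zero | h_zero
  · rw [(Metric.ediam_eq_zero_iff.1 h_zero).eq_singleton_of_mem hxA]
    exact (measure_mono inter_subset_left).trans (by simp [hν.measure_singleton])
  set d := (Metric.ediam A).toReal with hd
  have hd_pos : 0 < d := ENNReal.toReal_pos h_zero h_ne_top
  have hd_le : d ≤ 2 / 5 := ENNReal.toReal_le_of_le_ofReal (by norm_num) hA
  have h_diamPow : diamPow d = 3 * Metric.ediam A ^ dimS := by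
    rw [diamPow, Real.mul_rpow (by norm_num) hd_pos.le, two_rpow_dimS,
      ENNReal.ofReal_mul (by norm_num), ← ENNReal.ofReal_rpow_of_pos hd_pos, hd,
      ENNReal.ofReal_toReal h_ne_top, ENNReal.ofReal_ofNat]
  have h_subset : A ⊆ Metric.closedBall x d := fun y hy => by
    rw [Metric.mem_closedBall, dist_edist]
    exact ENNReal.toReal_mono h_ne_top (Metric.edist_le_ediam_of_mem hy hxA)
  calc ν (A ∩ gasket) ≤ ν (Metric.closedBall x d) := measure_mono (inter_subset_left.trans h_subset)
    _ ≤ b * diamPow d :=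
        (density_le_iff hd_pos).1 (hν.density_le_of_mem_upperBounds hb hx hd_pos hd_le)
    _ = b * (3 * Metric.ediam A ^ dimS) := by rw [h_diamPow]

lemma hausdorffMeasure_ne_zero (hν : IsSelfSimilar ν) : μH[dimS] gasket ≠ 0 := by
  obtain ⟨b, hb⟩ := hν.exists_isGreatest_typicalDensities
  have hb_top : b * 3 ≠ ⊤ :=
    ENNReal.mul_ne_top (hν.ne_top_of_mem_typicalDensities hb.1) ENNReal.ofNat_ne_top
  -- the mass distribution principle
  have h_le : (b * 3)⁻¹ • ν ≤ μH[dimS] := by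
    refine Measure.le_hausdorffMeasure dimS _ (ENNReal.ofReal (2 / 5)) (by simp) fun A hA => ?_
    rw [Measure.smul_apply, smul_eq_mul, ← ENNReal.div_eq_inv_mul]
    refine ENNReal.div_le_of_le_mul' ?_
    rw [mul_assoc]
    exact hν.measure_le_mul_ediam_rpow hb.2 hA
  have h_pos : 0 < ((b * 3)⁻¹ • ν) gasket :=
    ENNReal.mul_pos (ENNReal.inv_ne_zero.2 hb_top) hν.measure_pos.ne'
  exact (h_pos.trans_le (h_le gasket)).ne'

end IsSelfSimilar

lemma sphericalHausdorff_le_centredHausdorff_gasket :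
    sphericalHausdorff dimS gasket ≤ centredHausdorff dimS gasket :=
  (sphericalHausdorff_eq gasket).trans_le <|
    (coveringPre_mono (subset_univ gasket) subset_rfl).trans
      (centredPre_le_centredHausdorff isClosed_gasket subset_rfl)

/-- `ν` is a self-similar measure with the same values as `α` on the gasket and on balls, so that
the densities of `α` are those of `ν`. -/
structure Represents (ν : Measure Plane) (α : Set Plane → ℝ≥0∞) : Prop where
  isSelfSimilar : IsSelfSimilar ν
  apply_gasket : α gasket = ν gasket
  apply_closedBall : ∀ x d, 0 < d → α (Metric.closedBall x d) = ν (Metric.closedBall x d)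

lemma IsScaling.exists_represents {β : Set Plane → ℝ≥0∞} (hβ : IsScaling β)
    (hβ₀ : β gasket ≠ 0) : ∃ ν, Represents ν (restrictGasket β) := by
  obtain ⟨μ, hμ⟩ := exists_isNaturalMeasure
  refine ⟨β gasket • μ, hμ.isSelfSimilar.smul hβ₀ hβ.ne_top, ?_, fun x d hd => ?_⟩
  · rw [restrictGasket, inter_self, Measure.smul_apply, hμ.measure_gasket, smul_eq_mul, mul_one]
  · rw [restrictGasket, Measure.smul_apply, smul_eq_mul,
      ← hβ.mul_measure_closedBall_eq hμ.isSelfSimilar x hd, hμ.measure_gasket, one_mul]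

lemma exists_represents {α : Set Plane → ℝ≥0∞} (hα : α ∈ metricMeasures) :
    ∃ ν, Represents ν α := by
  obtain ⟨μ, hμ⟩ := exists_isNaturalMeasure
  obtain ⟨hC_pos, hC_top⟩ := hμ.isSelfSimilar.centredHausdorff_pos_lt_top
  obtain ⟨hP_pos, hP_top⟩ := hμ.isSelfSimilar.packing_pos_lt_top
  have hS_top := sphericalHausdorff_le_centredHausdorff_gasket.trans_lt hC_top
  have hH_le := hausdorffMeasure_le_sphericalHausdorff gasket
  have hH₀ := hμ.isSelfSimilar.hausdorffMeasure_ne_zero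
  rcases hα with ⟨ν, hν, rfl⟩ | rfl | rfl | rfl | rfl
  · exact ⟨ν, hν.isSelfSimilar, rfl, fun _ _ _ => rfl⟩
  · exact (isScaling_hausdorffMeasure (hH_le.trans_lt hS_top).ne).exists_represents hH₀
  · exact (isScaling_sphericalHausdorff hS_top.ne).exists_represents
      ((pos_iff_ne_zero.2 hH₀).trans_le hH_le).ne'
  · exact (isScaling_centredHausdorff hC_top.ne).exists_represents hC_pos.ne'
  · exact (isScaling_packing hP_top.ne).exists_represents hP_pos.ne'

namespace Represents

variable {ν : Measure Plane} {α : Set Plane → ℝ≥0∞}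

lemma density_eq (h : Represents ν α) (x : Plane) {d : ℝ} (hd : 0 < d) :
    density α x d = density ν x d := by
  rw [density, density, h.apply_closedBall x d hd]

lemma densitySpectrum_eq (h : Represents ν α) (A : Set Plane) :
    densitySpectrum α A = densitySpectrum ν A := by
  rw [densitySpectrum_eq_biUnion α, densitySpectrum_eq_biUnion ν]
  exact iUnion₂_congr fun x _ => densitySpectrum_congr fun d hd => h.density_eq x hd

lemma typicalDensities_eq (h : Represents ν α) : typicalDensities α = typicalDensities ν := by
  ext l
  constructor <;> rintro ⟨x, d, hx, rfl⟩
  · exact ⟨x, d, hx, h.density_eq x hx.2.1⟩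
  · exact ⟨x, d, hx, (h.density_eq x hx.2.1).symm⟩

lemma vertexDensities_eq (h : Represents ν α) : vertexDensities α = vertexDensities ν := by
  ext l
  constructor <;> rintro ⟨d, hd, rfl⟩
  · exact ⟨d, hd, h.density_eq _ (by linarith [hd.1])⟩
  · exact ⟨d, hd, (h.density_eq _ (by linarith [hd.1])).symm⟩

lemma lowerDensity_eq (h : Represents ν α) (x : Plane) :
    lowerDensity α x = lowerDensity ν x :=
  liminf_congr (eventually_nhdsWithin_of_forall fun _ hd => h.density_eq x hd)

lemma upperDensity_eq (h : Represents ν α) (x : Plane) :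
    upperDensity α x = upperDensity ν x :=
  limsup_congr (eventually_nhdsWithin_of_forall fun _ hd => h.density_eq x hd)

end Represents

end SierpinskiGasket

end

theorem theorem4p1 (α : Set Plane → ℝ≥0∞) (hα : α ∈ metricMeasures) :
    -- all the quantities involved are positive and finite
    ((0 < α gasket ∧ α gasket < ⊤) ∧
      (0 < packing dimS gasket ∧ packing dimS gasket < ⊤) ∧
      (0 < centredHausdorff dimS gasket ∧ centredHausdorff dimS gasket < ⊤)) ∧
    -- (i)
    ((∀ y ∈ denseOrbitPoints,
        densitySpectrum α {y} = densitySpectrum α denseOrbitPoints) ∧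
      (∀ R : Set Plane, IsFeasible R →
        densitySpectrum α denseOrbitPoints
          = densitySpectrum α (R ∩ gasket) ∧
        densitySpectrum α (R ∩ gasket) = typicalDensities α) ∧
      densitySpectrum α denseOrbitPoints = typicalDensities α ∧
      typicalDensities α
        = Icc (α gasket / packing dimS gasket) (α gasket / centredHausdorff dimS gasket)) ∧
    -- (ii)
    (densitySpectrum α gasket
        = Icc (lowerDensity α (vertex 0)) (upperDensity α (vertex 0)) ∪
          Icc (α gasket / packing dimS gasket) (α gasket / centredHausdorff dimS gasket) ∧
      lowerDensity α (vertex 0) < upperDensity α (vertex 0) ∧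
      α gasket / packing dimS gasket < α gasket / centredHausdorff dimS gasket ∧
      IsLeast {l | ∃ d ∈ Icc (1 / 2 : ℝ) 1, l = density α (vertex 0) d}
        (lowerDensity α (vertex 0)) ∧
      IsGreatest {l | ∃ d ∈ Icc (1 / 2 : ℝ) 1, l = density α (vertex 0) d}
        (upperDensity α (vertex 0))) := by
  obtain ⟨ν, h⟩ := exists_represents hα
  have hν := h.isSelfSimilar
  have hIcc := hν.typicalDensities_eq_Icc hν.isLeast_typicalDensities
    hν.isGreatest_typicalDensities
  have hl := hν.isLeast_lowerDensity
  have hu := hν.isGreatest_upperDensity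
  rw [← h.vertexDensities_eq] at hl hu
  simp only [h.densitySpectrum_eq, h.typicalDensities_eq, h.lowerDensity_eq, h.upperDensity_eq,
    h.apply_gasket]
  refine ⟨⟨⟨hν.measure_pos, lt_top_iff_ne_top.2 (hν.measure_ne_top _)⟩, hν.packing_pos_lt_top,
    hν.centredHausdorff_pos_lt_top⟩, ⟨fun y hy => ?_, fun R hR => ⟨?_, ?_⟩, ?_, hIcc⟩,
    ?_, hν.lowerDensity_lt_upperDensity, ?_, hl, hu⟩
  · rw [hν.densitySpectrum_of_mem_denseOrbitPoints hy, hν.densitySpectrum_denseOrbitPoints]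
  · rw [hν.densitySpectrum_denseOrbitPoints, hν.densitySpectrum_feasible_inter_gasket hR]
  · exact hν.densitySpectrum_feasible_inter_gasket hR
  · exact hν.densitySpectrum_denseOrbitPoints
  · rw [hν.densitySpectrum_gasket, hν.vertexDensities_eq_Icc, hIcc]
  · exact hν.lt_of_isLeast_of_isGreatest hν.isLeast_typicalDensities
      hν.isGreatest_typicalDensities
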